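/- **Setting.** States are binary, $\theta_t\in\{0,1\}$, and $T\ge 1$ is the horizon. A next-token model $\mathcal M$ assigns to each prefix $\theta_1,\dots,\theta_{t-1}$ a distribution $\mathcal M(\cdot\mid\theta_1,\dots,\theta_{t-1})$ on $\{0,1\}$ and induces the distribution $D(\mathcal M)$ on $\{0,1\}^T$ with $\Pr[\theta]=\prod_{t=1}^T\mathcal M(\theta_t\mid\theta_1,\dots,\theta_{t-1})$. The Polya urn model is $\mathcal M_{\mathrm{Polya}}(x\mid\theta_1,\dots,\theta_{t-1})=\frac{1+\#\{s<t:\theta_s=x\}}{2+(t-1)}$. For $v\in[0,1]$ the V-shaped score (a loss) with tip $v$ is $$\ell_v(p,0)=-|p-v|-p\,\mathrm{sign}(v-p),\qquad \ell_v(p,1)=-|p-v|+(1-p)\,\mathrm{sign}(v-p),$$ with $\mathrm{sign}(0)=0$. For forecasts $p_1,\dots,p_t$ of the state $1$, $$\mathrm{ExtReg}_t(\ell_v)=\tfrac1t\sum_{s\le t}\ell_v(p_s,\theta_s)-\min_{p\in[0,1]}\tfrac1t\sum_{s\le t}\ell_v(p,\theta_s).$$ **Algorithm.** Let $\mathcal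 V_\varepsilon=\{0,\varepsilon,2\varepsilon,\dots,1\}$ with $\varepsilon=1/T$, $N_\varepsilon=|\mathcal V_\varepsilon|$, $\delta=T^{-(1+\alpha)}$, and $b(t)=c\sqrt{\log(N_\varepsilon t^2/\delta)/t}$. Given a primary model $\mathcal M_0$ with forecasts $p^0_t=\mathcal M_0(1\mid\theta_1,\dots,\theta_{t-1})$, let $\widehat\Delta_t=\max_{v\in\mathcal V_\varepsilon}\mathrm{ExtReg}_t(\ell_v)$ for the forecasts $p^0_1,\dots,p^0_t$ and the states $\theta_1,\dots,\theta_t$. The model $\mathcal M$ predicts at round $t$ as $\mathcal M_{\mathrm{Polya}}$ if $\widehat\Delta_s>b(s)$ for some $1\le s\le t-1$, and as $\mathcal M_0$ otherwise. It does not use the decision problem. **Decision maker.** For a nonempty finite action set $A$ and a utility $U:A\times\{0,1\}\to[-1,1]$, a smooth-best-responding decision maker plays, at a belief $\mu$, the quantal best response with temperature $1/\sqrt T$: action $a$ has probability proportional to $\exp(\sqrt T\,\mathbb E_{\theta\sim\mu}U(a,\theta))$. The regret of the mixed actions $\pi_1,\dots,\pi_T$ is $\max_{a\in A}\frac1T\sum_{t=1}^T\big(U(a,\theta_t)-U(\pi_t,\theta_t)\big)$.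 **Theorem.** There are universal constants $c,C>0$ such that for all $\alpha>0$ and $T\ge1$: 1. $N_\varepsilon\le C\,T$, and if $T\ge2$ then $b(t)\le C\sqrt{(1+\alpha)\log T/t}$ for all $1\le t\le T$; in particular $b(T)\le C\sqrt{(1+\alpha)\log T/T}$. 2. For every model $\mathcal M_0$, every nonempty finite $A$, every $U:A\times\{0,1\}\to[-1,1]$ and every sequence $\theta\in\{0,1\}^T$, the smooth-best-responding decision maker who follows $\mathcal M$ has regret at most $$C\left(\frac{\log(|A|\,T)}{\sqrt T}+\sqrt{\frac{(1+\alpha)\log T}{T}}\right).$$ 3. For every model $\mathcal M_0$ and every nonempty finite $A$, $d_{\mathrm{TV}}\big(D(\mathcal M),D(\mathcal M_0)\big)\le|A|\,T^{-\alpha}$. -/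

import Mathlib

open scoped ENNReal

noncomputable section

/-! ### Next-token prediction models -/

/-- A next-token prediction model over the alphabet `Θ`: to every prefix
`(θ₁, …, θₙ)` (written as a function on `Fin n`) it assigns a distribution of the next token. -/
abbrev NextTokenModel (Θ : Type*) := (n : ℕ) → (Fin n → Θ) → PMF Θ

/-- The initial segment of length `n ≤ m` of a sequence of length `m`. -/
def initSeg {Θ : Type*} {m n : ℕ} (h : n ≤ m) (θ : Fin m → Θ) : Fin n → Θ :=
  fun s => θ (Fin.castLE h s)

/-- The tokens seen strictly before round `t`. -/
def past {Θ : Type*} {T : ℕ} (θ : Fin T → Θ) (t : Fin T) : Fin t.val → Θ :=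
  initSeg t.isLt.le θ

theorem sum_prod_model {Θ : Type*} [Fintype Θ] (M : NextTokenModel Θ) (T : ℕ) :
    ∑ θ : Fin T → Θ, ∏ t : Fin T, M t.val (past θ t) (θ t) = 1 := by
  induction T with
  | zero => simp
  | succ n ih =>
    rw [← (Fin.snocEquiv (fun _ : Fin (n + 1) => Θ)).sum_comp, Fintype.sum_prod_type_right]
    have key : ∀ (θ : Fin n → Θ) (x : Θ),
        (∏ t : Fin (n + 1), M t.val
          (past ((Fin.snocEquiv (fun _ : Fin (n + 1) => Θ)) (x, θ)) t)
          ((Fin.snocEquiv (fun _ : Fin (n + 1) => Θ)) (x, θ) t))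
        = (∏ t : Fin n, M t.val (past θ t) (θ t)) * M n θ x := by
      intro θ x
      rw [Fin.prod_univ_castSucc]
      congr 1
      · refine Finset.prod_congr rfl fun t _ => ?_
        have h1 : past ((Fin.snocEquiv (fun _ : Fin (n + 1) => Θ)) (x, θ)) t.castSucc
            = past θ t := by
          funext s
          exact Fin.snoc_castSucc (α := fun _ : Fin (n + 1) => Θ) x θ (Fin.castLE t.isLt.le s)
        have h2 : (Fin.snocEquiv (fun _ : Fin (n + 1) => Θ)) (x, θ) t.castSucc = θ t :=
          Fin.snoc_castSucc (α := fun _ : Fin (n + 1) => Θ) x θ t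
        rw [h2]
        exact congrArg (fun h => M t.val h (θ t)) h1
      · have h1 : past ((Fin.snocEquiv (fun _ : Fin (n + 1) => Θ)) (x, θ)) (Fin.last n)
            = θ := by
          funext s
          exact Fin.snoc_castSucc (α := fun _ : Fin (n + 1) => Θ) x θ s
        have h2 : (Fin.snocEquiv (fun _ : Fin (n + 1) => Θ)) (x, θ) (Fin.last n) = x :=
          Fin.snoc_last (α := fun _ : Fin (n + 1) => Θ) x θ
        rw [h2]
        exact congrArg (fun h => M n h x) h1
    simp_rw [key, ← Finset.mul_sum]
    have hM : ∀ θ : Fin n → Θ, ∑ x, M n θ x = 1 := fun θ => by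
      rw [← tsum_fintype (L := .unconditional _)]; exact (M n θ).tsum_coe
    simp_rw [hM, mul_one]
    exact ih

/-- The distribution `D(M)` over sequences of length `T` induced by a model:
`Pr[θ] = ∏ₜ M(θₜ ∣ θ₁, …, θₜ₋₁)`. -/
def inducedDist {Θ : Type*} [Fintype Θ] (M : NextTokenModel Θ) (T : ℕ) : PMF (Fin T → Θ) :=
  PMF.ofFintype (fun θ => ∏ t : Fin T, M t.val (past θ t) (θ t)) (sum_prod_model M T)

/-- Total variation distance of two distributions on a finite type. -/
def tvDist {Ω : Type*} [Fintype Ω] (P Q : PMF Ω) : ℝ :=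
  (1 / 2) * ∑ ω, |(P ω).toReal - (Q ω).toReal|

theorem sum_polya {Θ : Type*} [Fintype Θ] [Nonempty Θ] [DecidableEq Θ] (n : ℕ) (h : Fin n → Θ) :
    ∑ x : Θ, ((1 + (Finset.univ.filter fun s => h s = x).card : ℕ) : ℝ≥0∞)
      / ((Fintype.card Θ + n : ℕ) : ℝ≥0∞) = 1 := by
  have hsum : ∑ x : Θ, (1 + (Finset.univ.filter fun s => h s = x).card) = Fintype.card Θ + n := by
    rw [Finset.sum_add_distrib]
    congr 1
    · simp
    · rw [← Finset.card_eq_sum_card_fiberwise (f := h) (s := Finset.univ) (t := Finset.univ)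
        (fun _ _ => Finset.mem_univ _)]
      simp
  simp_rw [div_eq_mul_inv]
  rw [← Finset.sum_mul, ← Nat.cast_sum, hsum]
  refine ENNReal.mul_inv_cancel ?_ (ENNReal.natCast_ne_top _)
  have : 0 < Fintype.card Θ := Fintype.card_pos
  exact_mod_cast (by omega : Fintype.card Θ + n ≠ 0)

/-- The Polya urn model: the next token is `x` with probability
`(1 + #{s : θₛ = x}) / (|Θ| + n)` after a prefix of length `n`. -/
def polyaUrn {Θ : Type*} [Fintype Θ] [Nonempty Θ] [DecidableEq Θ] : NextTokenModel Θ :=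
  fun n h => PMF.ofFintype
    (fun x => ((1 + (Finset.univ.filter fun s => h s = x).card : ℕ) : ℝ≥0∞)
      / ((Fintype.card Θ + n : ℕ) : ℝ≥0∞)) (sum_polya n h)

/-! ### Decision makers -/

/-- Expected utility `U(a, μ)` of an action when the state has law `μ`. -/
def expUtil {A Θ : Type*} [Fintype Θ] (U : A → Θ → ℝ) (a : A) (μ : PMF Θ) : ℝ :=
  ∑ x, (μ x).toReal * U a x

/-- Quantal (smooth) best response to the belief `μ` at temperature `η`: the mixed action that
plays `a` with probability proportional to `exp (U(a, μ) / η)`. -/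
def qbr {A Θ : Type*} [Fintype A] [Fintype Θ] (U : A → Θ → ℝ) (μ : PMF Θ) (η : ℝ) (a : A) : ℝ :=
  Real.exp (1 / η * expUtil U a μ) / ∑ b, Real.exp (1 / η * expUtil U b μ)

/-- Average external regret of a sequence of mixed actions against a sequence of states. -/
def extReg {A Θ : Type*} [Fintype A] [Nonempty A] (U : A → Θ → ℝ) {T : ℕ}
    (π : Fin T → A → ℝ) (θ : Fin T → Θ) : ℝ :=
  Finset.univ.sup' Finset.univ_nonempty fun a =>
    (1 / (T : ℝ)) * ∑ t, (U a (θ t) - ∑ b, π t b * U b (θ t))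

/-! ### V-shaped scores and the switching algorithm

The binary state space is `Bool`, with `true` for the state `1`; a forecast is the probability of
`true`. -/

/-- The V-shaped score (a loss) with tip `v`, obtained from the univariate function
`p ↦ -|p - v|` and its supergradient `sign (v - p)`. -/
def vScore (v p : ℝ) (y : Bool) : ℝ :=
  if y = true then -|p - v| + (1 - p) * Real.sign (v - p)
  else -|p - v| - p * Real.sign (v - p)

/-- Average regret of the forecasts `p` under the loss `ℓ`, with respect to the best constant
forecast in `[0, 1]` in hindsight. -/
def scoreRegret (ℓ : ℝ → Bool → ℝ) {n : ℕ} (p : Fin n → ℝ) (y : Fin n → Bool) : ℝ :=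
  (1 / (n : ℝ)) * ∑ t, ℓ (p t) (y t)
    - ⨅ q : unitInterval, (1 / (n : ℝ)) * ∑ t, ℓ (q : ℝ) (y t)

/-- The grid `{0, 1/m, 2/m, …, 1}` of tips (mesh `ε = 1/m`). -/
def tipGrid (m : ℕ) : Finset ℝ :=
  (Finset.range (m + 1)).image fun k : ℕ => (k : ℝ) / (m : ℝ)

theorem tipGrid_nonempty (m : ℕ) : (tipGrid m).Nonempty :=
  (Finset.nonempty_range_add_one).image _

/-- The forecasts (of the state `true`) that a model makes along a sequence. -/
def forecasts (M : NextTokenModel Bool) {n : ℕ} (y : Fin n → Bool) : Fin n → ℝ :=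
  fun t => (M t.val (past y t) true).toReal

/-- The empirical gap of a model on a prefix: its maximal V-shaped-score regret over the grid. -/
def vGap (m : ℕ) (M : NextTokenModel Bool) {n : ℕ} (y : Fin n → Bool) : ℝ :=
  (tipGrid m).sup' (tipGrid_nonempty m) fun v => scoreRegret (vScore v) (forecasts M y) y

/-- The confidence threshold `c √(log (N t² / δ) / t)`, where `N` is the size of the grid. -/
def vThreshold (c : ℝ) (m : ℕ) (δ : ℝ) (t : ℕ) : ℝ :=
  c * √(Real.log (((tipGrid m).card : ℝ) * (t : ℝ) ^ 2 / δ) / (t : ℝ))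

/-- The algorithm has switched by the time it has seen the prefix `y` of length `n`: on some
nonempty initial segment of `y` the gap of the primary model exceeded the threshold. -/
def HasSwitched (c : ℝ) (m : ℕ) (δ : ℝ) (M₀ : NextTokenModel Bool) {n : ℕ}
    (y : Fin n → Bool) : Prop :=
  ∃ (s : ℕ) (hs : s ≤ n), 1 ≤ s ∧ vThreshold c m δ s < vGap m M₀ (initSeg hs y)

open Classical in
/-- The output of the switching algorithm: the primary model `M₀` until the switch, the Polya urn
model from then on. -/
def switchModel (c : ℝ) (m : ℕ) (δ : ℝ) (M₀ : NextTokenModel Bool) : NextTokenModel Bool :=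
  fun n y => if HasSwitched c m δ M₀ y then polyaUrn n y else M₀ n y

end

/-! The quantal response at temperature `η` is the gradient of a soft maximum `G` of the expected
utilities. `G` is convex in the belief, has slope at most 2 and curvature of order `1 / η`. The
realized utility at forecast `p` equals `G p + (y - p) * G' p`, the proper score generated by `G`,
up to an entropy term at most `η log |A|`.

Regret, before the switch. A piecewise linear interpolation of `G` on the grid of tips generates a
nonnegative mixture of V-shaped scores of total weight `O(1)`. Small V-shaped regrets of the primary
model therefore make its proper score nearly as large as `t G(mean)`, for every decision problem at
once (`SmoothConvex.mul_mean_le`).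

Regret, after the switch. The potential is `Φ_t = (2 + t) G(Polya forecast)`, minus the utility
earned so far. While Polya forecasts are played it grows per round by the entropy term and at most
`K / (t + 3)`, with `K = 8 / η` (`SmoothConvex.polya_step`). At the switch itself it grows by `O(1 +
η log |A|)`, and before the switch it is controlled by `t b(t)`. Since `G` dominates each action's
expected utility, the final potential bounds the regret (`potential_le`, `regret_sum_le`). The
choice `η = 1 / √T` balances `T η log |A|` against `K log T`.

Closeness in law. The two models differ only on sequences where the gap test fires by time `T - 1`.
When it fires, one of finitely many bets against the forecasts of `M₀` has won more than `s b(s)`.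
Under `M₀` these bets have nonpositive conditional mean and bounded payoff, so an exponential
supermartingale bounds each probability (`prob_bet_gt_le`). A union bound over times, tips and two
signs finishes. -/

/-! ### The soft maximum of the expected utilities -/

/-- The real number `1` or `0` coding a binary state. -/
noncomputable def boolReal (y : Bool) : ℝ := if y = true then 1 else 0

theorem boolReal_nonneg (y : Bool) : 0 ≤ boolReal y := by
  cases y <;> simp [boolReal]

theorem boolReal_le_one (y : Bool) : boolReal y ≤ 1 := by
  cases y <;> simp [boolReal]

theorem pmf_bool_false (μ : PMF Bool) : (μ false).toReal = 1 - (μ true).toReal := by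
  have h := μ.tsum_coe
  rw [tsum_fintype, Fintype.sum_bool] at h
  have h2 := congrArg ENNReal.toReal h
  rw [ENNReal.toReal_add (μ.apply_ne_top _) (μ.apply_ne_top _), ENNReal.toReal_one] at h2
  linarith

theorem pmf_toReal_le_one (μ : PMF Bool) (x : Bool) : (μ x).toReal ≤ 1 := by
  simpa using ENNReal.toReal_mono ENNReal.one_ne_top (μ.coe_le_one x)

section SoftMax

variable {A : Type*} [Fintype A]

/-- Expected utility of an action when the state is `true` with probability `p`. -/
noncomputable def linUtil (U : A → Bool → ℝ) (a : A) (p : ℝ) : ℝ :=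
  (1 - p) * U a false + p * U a true

/-- Partition function of the quantal response. -/
noncomputable def qbrZ (U : A → Bool → ℝ) (η p : ℝ) : ℝ :=
  ∑ b, Real.exp (1 / η * linUtil U b p)

/-- The quantal response to the belief that the state is `true` with probability `p`. -/
noncomputable def qbrAt (U : A → Bool → ℝ) (η p : ℝ) (a : A) : ℝ :=
  Real.exp (1 / η * linUtil U a p) / qbrZ U η p

/-- The soft maximum of the expected utilities at temperature `η`. -/
noncomputable def softMax (U : A → Bool → ℝ) (η p : ℝ) : ℝ := η * Real.log (qbrZ U η p)

/-- The slope of the soft maximum. -/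
noncomputable def softSlope (U : A → Bool → ℝ) (η p : ℝ) : ℝ :=
  ∑ b, qbrAt U η p b * (U b true - U b false)

theorem qbr_eq_qbrAt (U : A → Bool → ℝ) (μ : PMF Bool) (η : ℝ) (a : A) :
    qbr U μ η a = qbrAt U η (μ true).toReal a := by
  have h : ∀ b, expUtil U b μ = linUtil U b (μ true).toReal := fun b => by
    rw [expUtil, Fintype.sum_bool, pmf_bool_false, linUtil]; ring
  simp only [qbr, qbrAt, qbrZ, h]

variable [Nonempty A] (U : A → Bool → ℝ) {η : ℝ} (p q : ℝ)

theorem qbrZ_pos : 0 < qbrZ U η p :=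
  Finset.sum_pos (fun _ _ => Real.exp_pos _) Finset.univ_nonempty

theorem qbrAt_pos (a : A) : 0 < qbrAt U η p a := div_pos (Real.exp_pos _) (qbrZ_pos U p)

theorem sum_qbrAt : ∑ a, qbrAt U η p a = 1 := by
  simp only [qbrAt]
  rw [← Finset.sum_div]
  exact div_self (qbrZ_pos U p).ne'

/-- Moving the belief tilts the weights exponentially, so the ratio of partition functions is a
moment generating function of the utility differences under the response at `p`. -/
theorem qbrZ_eq_mul :
    qbrZ U η q = qbrZ U η p *
      ∑ b, qbrAt U η p b * Real.exp ((q - p) / η * (U b true - U b false)) := by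
  rw [Finset.mul_sum, qbrZ]
  refine Finset.sum_congr rfl fun b _ => ?_
  rw [qbrAt, ← mul_assoc, mul_div_cancel₀ _ (qbrZ_pos U p).ne', ← Real.exp_add]
  congr 1
  simp only [linUtil]
  ring

theorem softMax_tangent (hη : 0 < η) :
    softMax U η p + (q - p) * softSlope U η p ≤ softMax U η q := by
  have hpos : 0 < ∑ b, qbrAt U η p b * Real.exp ((q - p) / η * (U b true - U b false)) :=
    Finset.sum_pos (fun b _ => mul_pos (qbrAt_pos U p b) (Real.exp_pos _)) Finset.univ_nonempty
  have hJ : Real.exp (∑ b, qbrAt U η p b * ((q - p) / η * (U b true - U b false))) ≤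
      ∑ b, qbrAt U η p b * Real.exp ((q - p) / η * (U b true - U b false)) := by
    simpa using convexOn_exp.map_sum_le (t := Finset.univ) (w := qbrAt U η p)
      (p := fun b => (q - p) / η * (U b true - U b false))
      (fun b _ => (qbrAt_pos U p b).le) (sum_qbrAt U p) (fun _ _ => Set.mem_univ _)
  have h1 := (Real.le_log_iff_exp_le hpos).2 hJ
  have h2 : ∑ b, qbrAt U η p b * ((q - p) / η * (U b true - U b false))
      = (q - p) * softSlope U η p / η := by
    rw [softSlope, Finset.mul_sum, Finset.sum_div]
    exact Finset.sum_congr rfl fun b _ => by ring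
  rw [h2, div_le_iff₀ hη] at h1
  rw [softMax, softMax, qbrZ_eq_mul U p q, Real.log_mul (qbrZ_pos U p).ne' hpos.ne']
  linarith

variable {U} (hU : ∀ a y, |U a y| ≤ 1)
include hU

omit [Fintype A] [Nonempty A] in
theorem abs_diff_le_two (a : A) : |U a true - U a false| ≤ 2 := by
  have h1 := abs_le.1 (hU a true)
  have h2 := abs_le.1 (hU a false)
  exact abs_le.2 ⟨by linarith, by linarith⟩

theorem abs_softSlope_le : |softSlope U η p| ≤ 2 := by
  calc |softSlope U η p| ≤ ∑ b, |qbrAt U η p b * (U b true - U b false)| :=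
        Finset.abs_sum_le_sum_abs _ _
    _ ≤ ∑ b, qbrAt U η p b * 2 := Finset.sum_le_sum fun b _ => by
        rw [abs_mul, abs_of_pos (qbrAt_pos U p b)]
        exact mul_le_mul_of_nonneg_left (abs_diff_le_two hU b) (qbrAt_pos U p b).le
    _ = 2 := by rw [← Finset.sum_mul, sum_qbrAt, one_mul]

/-- For `|q - p| ≤ η / 2` this is `exp x ≤ 1 + x + x²` on `|x| ≤ 1` together with `log x ≤ x - 1`.
Farther away, slopes bounded by 2 leave a remainder of at most `4 |q - p|`, which the quadratic term
then dominates. -/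
theorem softMax_le_quadratic (hη : 0 < η) :
    softMax U η q ≤ softMax U η p + (q - p) * softSlope U η p + 8 / η * (q - p) ^ 2 := by
  rcases le_or_gt (2 * |q - p|) η with h | h
  · have hpos : 0 < ∑ b, qbrAt U η p b * Real.exp ((q - p) / η * (U b true - U b false)) :=
      Finset.sum_pos (fun b _ => mul_pos (qbrAt_pos U p b) (Real.exp_pos _))
        Finset.univ_nonempty
    have hb : ∀ b, Real.exp ((q - p) / η * (U b true - U b false)) ≤
        1 + (q - p) / η * (U b true - U b false) + 4 * ((q - p) / η) ^ 2 := fun b => by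
      have hd := abs_diff_le_two hU b
      have hx : |(q - p) / η * (U b true - U b false)| ≤ 1 := by
        rw [abs_mul, abs_div, abs_of_pos hη]
        calc |q - p| / η * |U b true - U b false| ≤ |q - p| / η * 2 := by gcongr
          _ = 2 * |q - p| / η := by ring
          _ ≤ 1 := (div_le_one hη).2 h
      have h1 := (abs_le.1 (Real.abs_exp_sub_one_sub_id_le hx)).2
      have h2 : (U b true - U b false) ^ 2 ≤ 4 := by
        rw [← sq_abs]; nlinarith [abs_nonneg (U b true - U b false)]
      have h3 : ((q - p) / η * (U b true - U b false)) ^ 2 ≤ 4 * ((q - p) / η) ^ 2 := by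
        rw [mul_pow]; nlinarith [sq_nonneg ((q - p) / η)]
      linarith
    have hsum : ∑ b, qbrAt U η p b * Real.exp ((q - p) / η * (U b true - U b false)) ≤
        1 + (q - p) / η * softSlope U η p + 4 * ((q - p) / η) ^ 2 := by
      calc _ ≤ ∑ b, qbrAt U η p b *
            (1 + (q - p) / η * (U b true - U b false) + 4 * ((q - p) / η) ^ 2) :=
            Finset.sum_le_sum fun b _ =>
              mul_le_mul_of_nonneg_left (hb b) (qbrAt_pos U p b).le
        _ = (∑ b, qbrAt U η p b) * (1 + 4 * ((q - p) / η) ^ 2)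
            + (q - p) / η * softSlope U η p := by
            rw [softSlope, Finset.sum_mul, Finset.mul_sum, ← Finset.sum_add_distrib]
            exact Finset.sum_congr rfl fun b _ => by ring
        _ = _ := by rw [sum_qbrAt]; ring
    have hl := Real.log_le_sub_one_of_pos hpos
    rw [softMax, softMax, qbrZ_eq_mul U p q, Real.log_mul (qbrZ_pos U p).ne' hpos.ne']
    have h4 : η * Real.log (∑ b, qbrAt U η p b *
        Real.exp ((q - p) / η * (U b true - U b false))) ≤
        η * ((q - p) / η * softSlope U η p + 4 * ((q - p) / η) ^ 2) := by
      apply mul_le_mul_of_nonneg_left _ hη.le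
      linarith
    have h5 : η * ((q - p) / η * softSlope U η p + 4 * ((q - p) / η) ^ 2)
        = (q - p) * softSlope U η p + 4 / η * (q - p) ^ 2 := by
      field_simp
    have h6 : 4 / η * (q - p) ^ 2 ≤ 8 / η * (q - p) ^ 2 := by gcongr; norm_num
    linarith
  · have h1 := softMax_tangent U q p hη
    have hs1 := abs_softSlope_le p hU (η := η)
    have hs2 := abs_softSlope_le q hU (η := η)
    have h2 : (q - p) * (softSlope U η q - softSlope U η p) ≤ 4 * |q - p| := by
      calc _ ≤ |(q - p) * (softSlope U η q - softSlope U η p)| := le_abs_self _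
        _ = |q - p| * |softSlope U η q - softSlope U η p| := abs_mul _ _
        _ ≤ |q - p| * 4 := by
            gcongr
            exact (abs_sub _ _).trans (by linarith)
        _ = _ := by ring
    have h3 : 4 * |q - p| ≤ 8 / η * (q - p) ^ 2 := by
      rw [div_mul_eq_mul_div, le_div_iff₀ hη, ← sq_abs (q - p)]
      nlinarith [abs_nonneg (q - p)]
    nlinarith

omit hU in
theorem linUtil_le_softMax (hη : 0 < η) (a : A) : linUtil U a p ≤ softMax U η p := by
  have h : Real.exp (1 / η * linUtil U a p) ≤ qbrZ U η p :=
    Finset.single_le_sum (f := fun b => Real.exp (1 / η * linUtil U b p))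
      (fun b _ => (Real.exp_pos _).le) (Finset.mem_univ a)
  have h1 := (Real.le_log_iff_exp_le (qbrZ_pos U p)).2 h
  rw [one_div, inv_mul_le_iff₀ hη] at h1
  exact h1

-- Gibbs identity: the expected utility under the response is the soft maximum minus `η` times the
-- entropy of the response, and entropy is at most `log |A|`. Replacing the belief by the realized
-- state only adds the slope term.
omit hU in
theorem softMax_sub_entropy_le (hη : 0 < η) (y : Bool) :
    softMax U η p + (boolReal y - p) * softSlope U η p - η * Real.log (Fintype.card A) ≤
      ∑ b, qbrAt U η p b * U b y := by
  have hu : ∀ b, U b y = linUtil U b p + (boolReal y - p) * (U b true - U b false) := fun b => by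
    cases y <;> simp [boolReal, linUtil] <;> ring
  have hlog : ∀ b, linUtil U b p = softMax U η p - η * Real.log (1 / qbrAt U η p b) := fun b => by
    rw [softMax, qbrAt, one_div_div, Real.log_div (qbrZ_pos U p).ne' (Real.exp_pos _).ne',
      Real.log_exp]
    field_simp
    ring
  have hent : ∑ b, qbrAt U η p b * Real.log (1 / qbrAt U η p b) ≤ Real.log (Fintype.card A) := by
    have := strictConcaveOn_log_Ioi.concaveOn.le_map_sum (t := Finset.univ) (w := qbrAt U η p)
      (p := fun b => 1 / qbrAt U η p b)
      (fun b _ => (qbrAt_pos U p b).le) (sum_qbrAt U p)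
      (fun b _ => Set.mem_Ioi.2 (one_div_pos.2 (qbrAt_pos U p b)))
    simp only [smul_eq_mul] at this
    refine this.trans (le_of_eq ?_)
    congr 1
    rw [Finset.sum_congr rfl fun b _ => mul_one_div_cancel (qbrAt_pos U p b).ne']
    simp
  have heq : ∑ b, qbrAt U η p b * U b y = softMax U η p + (boolReal y - p) * softSlope U η p
      - η * ∑ b, qbrAt U η p b * Real.log (1 / qbrAt U η p b) := by
    calc _ = ∑ b, (qbrAt U η p b * softMax U η p
          + (boolReal y - p) * (qbrAt U η p b * (U b true - U b false))
          - η * (qbrAt U η p b * Real.log (1 / qbrAt U η p b))) :=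
          Finset.sum_congr rfl fun b _ => by rw [hu b, hlog b]; ring
      _ = _ := by
          rw [Finset.sum_sub_distrib, Finset.sum_add_distrib, ← Finset.sum_mul, sum_qbrAt,
            ← Finset.mul_sum, ← Finset.mul_sum, one_mul, softSlope]
  rw [heq]
  have := mul_le_mul_of_nonneg_left hent hη.le
  linarith

theorem softMax_le (hη : 0 < η) (hp0 : 0 ≤ p) (hp1 : p ≤ 1) :
    softMax U η p ≤ 1 + η * Real.log (Fintype.card A) := by
  have hl : ∀ b, linUtil U b p ≤ 1 := fun b => by
    have h1 := abs_le.1 (hU b true)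
    have h2 := abs_le.1 (hU b false)
    rw [linUtil]
    nlinarith
  have hZ : qbrZ U η p ≤ Fintype.card A * Real.exp (1 / η) := by
    calc qbrZ U η p ≤ ∑ _b : A, Real.exp (1 / η) := Finset.sum_le_sum fun b _ =>
          Real.exp_le_exp.2 (mul_le_of_le_one_right (by positivity) (hl b))
      _ = _ := by simp
  have hc : (0 : ℝ) < Fintype.card A := by exact_mod_cast Fintype.card_pos
  have h1 := Real.log_le_log (qbrZ_pos U p) hZ
  rw [Real.log_mul hc.ne' (Real.exp_pos _).ne', Real.log_exp] at h1
  have h2 := mul_le_mul_of_nonneg_left h1 hη.le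
  rw [softMax]
  have h3 : η * (Real.log (Fintype.card A) + 1 / η) = 1 + η * Real.log (Fintype.card A) := by
    field_simp
    ring
  linarith

theorem neg_one_le_qbr_utility (y : Bool) : -1 ≤ ∑ b, qbrAt U η p b * U b y := by
  calc (-1 : ℝ) = ∑ b, qbrAt U η p b * (-1) := by rw [← Finset.sum_mul, sum_qbrAt, one_mul]
    _ ≤ _ := Finset.sum_le_sum fun b _ =>
        mul_le_mul_of_nonneg_left (abs_le.1 (hU b y)).1 (qbrAt_pos U p b).le

end SoftMax

/-! ### V-shaped scores -/

/-- In this form the score separates: the forecast enters only through a sign, so a constant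
forecast factors out of a sum over rounds. -/
theorem vScore_eq (v p : ℝ) (y : Bool) : vScore v p y = (boolReal y - v) * Real.sign (v - p) := by
  rcases lt_trichotomy (v - p) 0 with h | h | h
  · have h2 : |p - v| = p - v := abs_of_pos (by linarith)
    cases y <;> simp [vScore, boolReal, Real.sign_of_neg h, h2]
  · have h2 : p - v = 0 := by linarith
    cases y <;> simp [vScore, boolReal, h, h2]
  · have h2 : |p - v| = v - p := by rw [abs_sub_comm]; exact abs_of_pos h
    cases y <;> simp [vScore, boolReal, Real.sign_of_pos h, h2]

theorem abs_sign_le_one (x : ℝ) : |Real.sign x| ≤ 1 := by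
  rcases Real.sign_apply_eq x with h | h | h <;> simp [h]

theorem abs_boolReal_sub_le {v : ℝ} (h0 : 0 ≤ v) (h1 : v ≤ 1) (y : Bool) :
    |boolReal y - v| ≤ 1 :=
  abs_le.2 ⟨by linarith [boolReal_nonneg y], by linarith [boolReal_le_one y]⟩

theorem abs_vScore_le {v : ℝ} (h0 : 0 ≤ v) (h1 : v ≤ 1) (p : ℝ) (y : Bool) :
    |vScore v p y| ≤ 1 := by
  rw [vScore_eq, abs_mul]
  exact mul_le_one₀ (abs_boolReal_sub_le h0 h1 y) (abs_nonneg _) (abs_sign_le_one _)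

theorem tipGrid_mem_Icc {m : ℕ} {v : ℝ} (hv : v ∈ tipGrid m) : 0 ≤ v ∧ v ≤ 1 := by
  obtain ⟨k, hk, rfl⟩ := Finset.mem_image.1 hv
  have hk' : k ≤ m := by have := Finset.mem_range.1 hk; omega
  refine ⟨by positivity, div_le_one_of_le₀ ?_ (by positivity)⟩
  exact_mod_cast hk'

theorem sum_vScore_sub_le {n : ℕ} (hn : 1 ≤ n) {v : ℝ} (h0 : 0 ≤ v) (h1 : v ≤ 1)
    (p : Fin n → ℝ) (y : Fin n → Bool) {q : ℝ} (hq0 : 0 ≤ q) (hq1 : q ≤ 1) :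
    ∑ t, vScore v (p t) (y t) - ∑ t, vScore v q (y t) ≤
      n * scoreRegret (vScore v) p y := by
  have hn' : (0 : ℝ) < n := by exact_mod_cast hn
  -- Needed because the real infimum of an unbounded family defaults to 0.
  have hb : BddBelow (Set.range fun q : unitInterval =>
      (1 / (n : ℝ)) * ∑ t, vScore v (q : ℝ) (y t)) := by
    refine ⟨(1 / (n : ℝ)) * ∑ _t : Fin n, (-1), ?_⟩
    rintro _ ⟨r, rfl⟩
    refine mul_le_mul_of_nonneg_left (Finset.sum_le_sum fun t _ => ?_) (by positivity)
    exact (abs_le.1 (abs_vScore_le h0 h1 _ _)).1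
  have h := ciInf_le hb ⟨q, hq0, hq1⟩
  have h2 : (n : ℝ) * ((1 / (n : ℝ)) * ∑ t, vScore v (p t) (y t)
      - (1 / (n : ℝ)) * ∑ t, vScore v q (y t)) ≤ n * scoreRegret (vScore v) p y := by
    refine mul_le_mul_of_nonneg_left ?_ hn'.le
    rw [scoreRegret]
    exact sub_le_sub_left h _
  refine le_trans (le_of_eq ?_) h2
  field_simp

/-! ### Discretization of smooth convex scores -/

/-- `D` is a bounded gradient of the convex function `G`, whose second-order remainder is at
most `K` times the squared distance. -/
structure SmoothConvex (G D : ℝ → ℝ) (K : ℝ) : Prop where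
  tangent : ∀ p q, G p + (q - p) * D p ≤ G q
  quadratic : ∀ p q, G q ≤ G p + (q - p) * D p + K * (q - p) ^ 2
  slope_le : ∀ p, |D p| ≤ 2

namespace SmoothConvex

variable {G D : ℝ → ℝ} {K : ℝ} (h : SmoothConvex G D K)
include h

theorem nonneg : 0 ≤ K := by
  have h1 := h.tangent 0 1
  have h2 := h.quadratic 0 1
  linarith

theorem slope_mono {p q : ℝ} (hpq : p ≤ q) : D p ≤ D q := by
  rcases hpq.eq_or_lt with rfl | hlt
  · exact le_rfl
  · have h1 := h.tangent p q
    have h2 := h.tangent q p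
    have : (q - p) * D p ≤ (q - p) * D q := by linarith
    exact le_of_mul_le_mul_left this (by linarith)

theorem slope_sub_le {p q : ℝ} (hpq : p ≤ q) : D q - D p ≤ 2 * K * (q - p) := by
  rcases hpq.eq_or_lt with rfl | hlt
  · simp
  · have h1 := h.quadratic p q
    have h2 := h.quadratic q p
    have : (q - p) * (D q - D p) ≤ (q - p) * (2 * K * (q - p)) := by nlinarith
    exact le_of_mul_le_mul_left this (by linarith)

end SmoothConvex

/-- Slope of `G` over the `k`-th cell of the grid of mesh `1 / m`. -/
noncomputable def gridSlope (m : ℕ) (G : ℝ → ℝ) (k : ℕ) : ℝ :=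
  m * (G ((k + 1 : ℕ) / m) - G ((k : ℕ) / m))

/-- The chord of `G` over the `k`-th cell of the grid, as an affine function. -/
noncomputable def cellScore (m : ℕ) (G : ℝ → ℝ) (k : ℕ) (y : ℝ) : ℝ :=
  G (k / m) + gridSlope m G k * (y - k / m)

/-- The proper score of the piecewise linear interpolation of `G` on the grid of mesh `1 / m`. -/
noncomputable def gridScore (m : ℕ) (G : ℝ → ℝ) (p y : ℝ) : ℝ :=
  G 0 + gridSlope m G 0 * y + ∑ k ∈ Finset.Ico 1 m,
    (gridSlope m G k - gridSlope m G (k - 1)) * ((y - k / m) * ((1 + Real.sign (p - k / m)) / 2))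

/-- Each kink term changes the slope at one breakpoint, turning the chord of a cell into the chord
of the next. -/
theorem cellScore_eq_sum {m : ℕ} (hm : 0 < m) (G : ℝ → ℝ) (j : ℕ) (y : ℝ) :
    G 0 + gridSlope m G 0 * y + ∑ k ∈ Finset.Ico 1 (j + 1),
      (gridSlope m G k - gridSlope m G (k - 1)) * (y - k / m) = cellScore m G j y := by
  have hm' : (m : ℝ) ≠ 0 := by exact_mod_cast hm.ne'
  induction j with
  | zero => simp [cellScore]
  | succ j ih =>
    rw [Finset.sum_Ico_succ_top (by omega), ← add_assoc, ih, cellScore, cellScore,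
      Nat.add_sub_cancel]
    have : G ((j + 1 : ℕ) / m) = G (j / m) + gridSlope m G j * (1 / m) := by
      rw [gridSlope]; field_simp; ring
    rw [this]
    push_cast
    ring

theorem half_one_add_sign (z : ℝ) :
    (1 + Real.sign z) / 2 = ((if 0 ≤ z then 1 else 0) + (if 0 < z then 1 else 0)) / 2 := by
  rcases lt_trichotomy z 0 with h | h | h
  · simp [Real.sign_of_neg h, not_le.2 h, not_lt.2 h.le]
  · simp [h]
  · simp [Real.sign_of_pos h, h.le, h]

/-- As `sign 0 = 0`, a forecast on a breakpoint gets the average of the chords on its two sides.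
Floor and ceiling select these cells; the minimum with `m - 1` handles `p = 1`, and truncated
subtraction handles `p = 0`. -/
theorem exists_gridScore_eq {m : ℕ} (hm : 0 < m) (G : ℝ → ℝ) {p : ℝ} (hp0 : 0 ≤ p)
    (hp1 : p ≤ 1) :
    ∃ i j : ℕ, ((i : ℝ) / m ≤ p ∧ p ≤ (i + 1) / m) ∧ ((j : ℝ) / m ≤ p ∧ p ≤ (j + 1) / m) ∧
      ∀ y, gridScore m G p y = (cellScore m G i y + cellScore m G j y) / 2 := by
  have hm' : (0 : ℝ) < m := by exact_mod_cast hm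
  have hpm : 0 ≤ p * m := by positivity
  have hm1 : ((m - 1 : ℕ) : ℝ) + 1 = m := by
    have : m - 1 + 1 = m := by omega
    exact_mod_cast this
  refine ⟨min ⌊p * m⌋₊ (m - 1), ⌈p * m⌉₊ - 1, ⟨?_, ?_⟩, ⟨?_, ?_⟩, fun y => ?_⟩
  · rw [div_le_iff₀ hm']
    exact le_trans (by exact_mod_cast min_le_left _ _) (Nat.floor_le hpm)
  · rw [le_div_iff₀ hm']
    rcases min_cases ⌊p * m⌋₊ (m - 1) with h | h
    · rw [h.1]; exact (Nat.lt_floor_add_one _).le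
    · rw [h.1, hm1]; nlinarith
  · rw [div_le_iff₀ hm']
    rcases Nat.eq_zero_or_pos ⌈p * m⌉₊ with h | h
    · simp [h, hpm]
    · exact (Nat.lt_ceil.1 (Nat.sub_lt h one_pos)).le
  · rw [le_div_iff₀ hm']
    refine (Nat.le_ceil (p * m)).trans ?_
    have : ⌈p * m⌉₊ ≤ ⌈p * m⌉₊ - 1 + 1 := by omega
    exact_mod_cast this
  · have hcm : ⌈p * m⌉₊ ≤ m := Nat.ceil_le.2 (by nlinarith)
    set f : ℕ → ℝ := fun k => (gridSlope m G k - gridSlope m G (k - 1)) * (y - k / m)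
    have h1 : ∑ k ∈ Finset.Ico 1 m, f k * (if 0 ≤ p - (k : ℝ) / m then 1 else 0) =
        ∑ k ∈ Finset.Ico 1 (min ⌊p * m⌋₊ (m - 1) + 1), f k := by
      simp only [mul_ite, mul_one, mul_zero]
      rw [← Finset.sum_filter]
      refine Finset.sum_congr ?_ fun _ _ => rfl
      ext k
      simp only [Finset.mem_filter, Finset.mem_Ico]
      rw [sub_nonneg, div_le_iff₀ hm', ← Nat.le_floor_iff hpm]
      omega
    have h2 : ∑ k ∈ Finset.Ico 1 m, f k * (if 0 < p - (k : ℝ) / m then 1 else 0) =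
        ∑ k ∈ Finset.Ico 1 (⌈p * m⌉₊ - 1 + 1), f k := by
      simp only [mul_ite, mul_one, mul_zero]
      rw [← Finset.sum_filter]
      refine Finset.sum_congr ?_ fun _ _ => rfl
      ext k
      simp only [Finset.mem_filter, Finset.mem_Ico]
      rw [sub_pos, div_lt_iff₀ hm', ← Nat.lt_ceil]
      omega
    have h3 : gridScore m G p y = G 0 + gridSlope m G 0 * y +
        ((∑ k ∈ Finset.Ico 1 m, f k * (if 0 ≤ p - (k : ℝ) / m then 1 else 0)) +
        ∑ k ∈ Finset.Ico 1 m, f k * (if 0 < p - (k : ℝ) / m then 1 else 0)) / 2 := by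
      rw [gridScore, ← Finset.sum_add_distrib, Finset.sum_div]
      congr 1
      refine Finset.sum_congr rfl fun k _ => ?_
      rw [half_one_add_sign]
      ring
    rw [h3, h1, h2, ← cellScore_eq_sum hm, ← cellScore_eq_sum hm]
    ring

/-- The chord slope and `D p` both lie between the end slopes of the cell, which differ by at most
`2K / m`. The slope and the value of the chord at `p` each contribute one such error. -/
theorem SmoothConvex.abs_cellScore_sub_le {G D : ℝ → ℝ} {K : ℝ} (h : SmoothConvex G D K)
    {m : ℕ} (hm : 0 < m) {j : ℕ} {p y : ℝ} (hp0 : 0 ≤ p) (hp1 : p ≤ 1) (hy0 : 0 ≤ y)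
    (hy1 : y ≤ 1) (hj : (j : ℝ) / m ≤ p) (hj' : p ≤ (j + 1) / m) :
    |cellScore m G j y - (G p + (y - p) * D p)| ≤ 4 * K / m := by
  have hm' : (0 : ℝ) < m := by exact_mod_cast hm
  have hK := h.nonneg
  set a : ℝ := j / m with ha
  set b : ℝ := (j + 1) / m with hb
  have hab : b - a = 1 / m := by rw [ha, hb]; ring
  have hm1 : 1 / (m : ℝ) ≤ 1 := by
    rw [div_le_one hm']; exact_mod_cast hm
  have hs : gridSlope m G j = m * (G b - G a) := by
    rw [gridSlope, ha, hb]; push_cast; rfl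
  have hGb : G b - G a = gridSlope m G j * (1 / m) := by rw [hs]; field_simp
  have h0m : 0 < 1 / (m : ℝ) := by positivity
  have hlo : D a ≤ gridSlope m G j := by
    have := h.tangent a b
    rw [hab] at this
    exact le_of_mul_le_mul_right (by linarith) h0m
  have hhi : gridSlope m G j ≤ D b := by
    have := h.tangent b a
    have hab' : a - b = -(1 / m) := by linarith
    rw [hab'] at this
    exact le_of_mul_le_mul_right (by linarith) h0m
  have hDab : D b - D a ≤ 2 * K * (1 / m) := by
    rw [← hab]; exact h.slope_sub_le (hj.trans hj')
  have hDap := h.slope_mono hj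
  have hDpb := h.slope_mono hj'
  have h1 : |gridSlope m G j - D p| ≤ 2 * K * (1 / m) := abs_le.2 ⟨by linarith, by linarith⟩
  have h2 : |G a + gridSlope m G j * (p - a) - G p| ≤ 2 * K * (1 / m) := by
    have t1 := h.tangent a p
    have t2 := h.tangent p a
    have hpa : 0 ≤ p - a := by linarith
    have hpa1 : p - a ≤ 1 := by linarith
    have u1 : (gridSlope m G j - D a) * (p - a) ≤ 2 * K * (1 / m) := by
      calc _ ≤ (2 * K * (1 / m)) * (p - a) := by gcongr; linarith
        _ ≤ (2 * K * (1 / m)) * 1 := by gcongr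
        _ = _ := mul_one _
    have u2 : (D p - gridSlope m G j) * (p - a) ≤ 2 * K * (1 / m) := by
      calc _ ≤ (2 * K * (1 / m)) * (p - a) := by gcongr; linarith
        _ ≤ (2 * K * (1 / m)) * 1 := by gcongr
        _ = _ := mul_one _
    exact abs_le.2 ⟨by nlinarith, by nlinarith⟩
  have h3 : |(y - p) * (gridSlope m G j - D p)| ≤ 2 * K * (1 / m) := by
    rw [abs_mul]
    calc _ ≤ 1 * |gridSlope m G j - D p| := by
          gcongr
          exact abs_le.2 ⟨by linarith, by linarith⟩
      _ ≤ _ := by rw [one_mul]; exact h1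
  have h4 : cellScore m G j y - (G p + (y - p) * D p) =
      (G a + gridSlope m G j * (p - a) - G p) + (y - p) * (gridSlope m G j - D p) := by
    rw [cellScore, ← ha]; ring
  rw [h4]
  refine (abs_add_le _ _).trans ?_
  calc _ ≤ 2 * K * (1 / m) + 2 * K * (1 / m) := add_le_add h2 h3
    _ = _ := by ring

theorem SmoothConvex.abs_gridScore_sub_le {G D : ℝ → ℝ} {K : ℝ} (h : SmoothConvex G D K)
    {m : ℕ} (hm : 0 < m) {p y : ℝ} (hp0 : 0 ≤ p) (hp1 : p ≤ 1) (hy0 : 0 ≤ y) (hy1 : y ≤ 1) :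
    |gridScore m G p y - (G p + (y - p) * D p)| ≤ 4 * K / m := by
  obtain ⟨i, j, hi, hj, he⟩ := exists_gridScore_eq hm G hp0 hp1
  have h1 := abs_le.1 (h.abs_cellScore_sub_le hm hp0 hp1 hy0 hy1 hi.1 hi.2)
  have h2 := abs_le.1 (h.abs_cellScore_sub_le hm hp0 hp1 hy0 hy1 hj.1 hj.2)
  rw [he]
  exact abs_le.2 ⟨by linarith, by linarith⟩

theorem SmoothConvex.gridSlope_mono {G D : ℝ → ℝ} {K : ℝ} (h : SmoothConvex G D K)
    {m : ℕ} (hm : 0 < m) (k : ℕ) :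
    D (k / m) ≤ gridSlope m G k ∧ gridSlope m G k ≤ D ((k + 1 : ℕ) / m) := by
  have hm' : (0 : ℝ) < m := by exact_mod_cast hm
  have hab : ((k + 1 : ℕ) : ℝ) / m - k / m = 1 / m := by push_cast; ring
  have hab' : (k : ℝ) / m - (k + 1 : ℕ) / m = -(1 / m) := by push_cast; ring
  have t1 := h.tangent (k / m) ((k + 1 : ℕ) / m)
  have t2 := h.tangent ((k + 1 : ℕ) / m) (k / m)
  rw [hab] at t1
  rw [hab'] at t2
  have h0m : 0 < 1 / (m : ℝ) := by positivity
  have hs : G ((k + 1 : ℕ) / m) - G (k / m) = gridSlope m G k * (1 / m) := by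
    rw [gridSlope]; field_simp
  exact ⟨le_of_mul_le_mul_right (by linarith) h0m, le_of_mul_le_mul_right (by linarith) h0m⟩

/-- Small V-shaped-score regrets bound the regret of every smooth convex score. -/
theorem SmoothConvex.mul_mean_le {G D : ℝ → ℝ} {K : ℝ} (h : SmoothConvex G D K)
    {m : ℕ} (hm : 0 < m) {n : ℕ} (hn : 1 ≤ n) (p : Fin n → ℝ) (hp0 : ∀ t, 0 ≤ p t)
    (hp1 : ∀ t, p t ≤ 1) (y : Fin n → Bool) {b : ℝ} (hb0 : 0 ≤ b)
    (hb : ∀ v ∈ tipGrid m, scoreRegret (vScore v) p y ≤ b) :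
    n * G ((∑ t, boolReal (y t)) / n) ≤
      ∑ t, (G (p t) + (boolReal (y t) - p t) * D (p t)) + n * (2 * b + 8 * K / m) := by
  have hn' : (0 : ℝ) < n := by exact_mod_cast hn
  have hm' : (0 : ℝ) < m := by exact_mod_cast hm
  set q := (∑ t, boolReal (y t)) / n with hq
  have hq0 : 0 ≤ q := div_nonneg (Finset.sum_nonneg fun t _ => boolReal_nonneg _) hn'.le
  have hq1 : q ≤ 1 := by
    rw [hq, div_le_one hn']
    calc _ ≤ ∑ _t : Fin n, (1 : ℝ) := Finset.sum_le_sum fun t _ => boolReal_le_one _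
      _ = n := by simp
  -- The linear terms cancel because `q` is the empirical mean.
  have hmean : n * G q = ∑ t, (G q + (boolReal (y t) - q) * D q) := by
    rw [Finset.sum_add_distrib, ← Finset.sum_mul, Finset.sum_sub_distrib]
    have : (n : ℝ) * q = ∑ t, boolReal (y t) := by rw [hq]; field_simp
    simp [← this]
  have e1 : ∀ t, G q + (boolReal (y t) - q) * D q ≤ gridScore m G q (boolReal (y t)) + 4 * K / m :=
    fun t => by
      have := (abs_le.1 (h.abs_gridScore_sub_le hm hq0 hq1 (boolReal_nonneg (y t))
        (boolReal_le_one (y t)))).1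
      linarith
  have e2 : ∀ t, gridScore m G (p t) (boolReal (y t)) ≤
      G (p t) + (boolReal (y t) - p t) * D (p t) + 4 * K / m := fun t => by
    have := (abs_le.1 (h.abs_gridScore_sub_le hm (hp0 t) (hp1 t) (boolReal_nonneg (y t))
        (boolReal_le_one (y t)))).2
    linarith
  have hw : ∀ k ∈ Finset.Ico 1 m, 0 ≤ gridSlope m G k - gridSlope m G (k - 1) := fun k hk => by
    have h1 := (h.gridSlope_mono hm k).1
    have h2 := (h.gridSlope_mono hm (k - 1)).2
    rw [Nat.sub_add_cancel (Finset.mem_Ico.1 hk).1] at h2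
    linarith
  -- The weights telescope to a difference of two slopes lying in `[-2, 2]`.
  have hwsum : ∑ k ∈ Finset.Ico 1 m, (gridSlope m G k - gridSlope m G (k - 1)) ≤ 4 := by
    have htel : ∑ k ∈ Finset.Ico 1 m, (gridSlope m G k - gridSlope m G (k - 1)) =
        gridSlope m G (m - 1) - gridSlope m G 0 := by
      rw [Finset.sum_Ico_eq_sum_range]
      simp only [add_comm 1]
      exact Finset.sum_range_sub (gridSlope m G) (m - 1)
    rw [htel]
    have h1 := (h.gridSlope_mono hm (m - 1)).2
    have h2 := (h.gridSlope_mono hm 0).1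
    have h3 := (abs_le.1 (h.slope_le ((m - 1 + 1 : ℕ) / m))).2
    have h4 := (abs_le.1 (h.slope_le ((0 : ℕ) / m))).1
    linarith
  -- All parts independent of the forecast cancel, leaving half the difference of V-shaped losses at
  -- each interior tip.
  have hdiff : ∀ t, gridScore m G q (boolReal (y t)) - gridScore m G (p t) (boolReal (y t)) =
      ∑ k ∈ Finset.Ico 1 m, (gridSlope m G k - gridSlope m G (k - 1)) *
        ((vScore (k / m) (p t) (y t) - vScore (k / m) q (y t)) / 2) := fun t => by
    rw [gridScore, gridScore, add_sub_add_left_eq_sub, ← Finset.sum_sub_distrib]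
    refine Finset.sum_congr rfl fun k _ => ?_
    rw [vScore_eq, vScore_eq, ← neg_sub (p t), ← neg_sub q, Real.sign_neg, Real.sign_neg]
    ring
  have hsum : ∑ t, (gridScore m G q (boolReal (y t)) - gridScore m G (p t) (boolReal (y t))) ≤
      n * (2 * b) := by
    calc _ = ∑ k ∈ Finset.Ico 1 m, (gridSlope m G k - gridSlope m G (k - 1)) *
        ((∑ t, vScore (k / m) (p t) (y t) - ∑ t, vScore (k / m) q (y t)) / 2) := by
          rw [Finset.sum_congr rfl fun t _ => hdiff t, Finset.sum_comm]
          refine Finset.sum_congr rfl fun k _ => ?_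
          rw [← Finset.mul_sum, ← Finset.sum_div, Finset.sum_sub_distrib]
      _ ≤ ∑ k ∈ Finset.Ico 1 m, (gridSlope m G k - gridSlope m G (k - 1)) * (n * b / 2) := by
          refine Finset.sum_le_sum fun k hk => mul_le_mul_of_nonneg_left ?_ (hw k hk)
          have hmem : (k : ℝ) / m ∈ tipGrid m := Finset.mem_image_of_mem _
            (Finset.mem_range.2 (by have := (Finset.mem_Ico.1 hk).2; omega))
          have hv := tipGrid_mem_Icc hmem
          have h1 := sum_vScore_sub_le hn hv.1 hv.2 p y hq0 hq1
          have h2 := mul_le_mul_of_nonneg_left (hb _ hmem) hn'.le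
          linarith
      _ = (∑ k ∈ Finset.Ico 1 m, (gridSlope m G k - gridSlope m G (k - 1))) * (n * b / 2) := by
          rw [Finset.sum_mul]
      _ ≤ 4 * (n * b / 2) := mul_le_mul_of_nonneg_right hwsum (by positivity)
      _ = _ := by ring
  have s1 := Finset.sum_le_sum fun t (_ : t ∈ Finset.univ) => e1 t
  have s2 := Finset.sum_le_sum fun t (_ : t ∈ Finset.univ) => e2 t
  rw [Finset.sum_sub_distrib] at hsum
  rw [Finset.sum_add_distrib (g := fun _ => 4 * K / (m : ℝ)), ← hmean] at s1
  rw [Finset.sum_add_distrib (g := fun _ => 4 * K / (m : ℝ))] at s2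
  simp only [Finset.sum_const, Finset.card_univ, Fintype.card_fin, nsmul_eq_mul] at s1 s2
  have : (n : ℝ) * (2 * b + 8 * K / m) = n * (2 * b) + n * (4 * K / m) + n * (4 * K / m) := by
    ring
  linarith

/-! ### The Polya potential -/

/-- Number of rounds before `t` in which the state is `true`. -/
noncomputable def trueCount (y : ℕ → Bool) (t : ℕ) : ℝ := ∑ s ∈ Finset.range t, boolReal (y s)

/-- Forecast of the Polya urn model in round `t`. -/
noncomputable def polyaForecast (y : ℕ → Bool) (t : ℕ) : ℝ := (1 + trueCount y t) / (2 + t)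

theorem trueCount_nonneg (y : ℕ → Bool) (t : ℕ) : 0 ≤ trueCount y t :=
  Finset.sum_nonneg fun _ _ => boolReal_nonneg _

theorem trueCount_le (y : ℕ → Bool) (t : ℕ) : trueCount y t ≤ t := by
  calc trueCount y t ≤ ∑ _s ∈ Finset.range t, (1 : ℝ) :=
        Finset.sum_le_sum fun _ _ => boolReal_le_one _
    _ = t := by simp

theorem polyaForecast_nonneg (y : ℕ → Bool) (t : ℕ) : 0 ≤ polyaForecast y t :=
  div_nonneg (by linarith [trueCount_nonneg y t]) (by positivity)

theorem polyaForecast_le_one (y : ℕ → Bool) (t : ℕ) : polyaForecast y t ≤ 1 :=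
  div_le_one_of_le₀ (by linarith [trueCount_le y t]) (by positivity)

theorem polyaForecast_mul (y : ℕ → Bool) (t : ℕ) :
    (2 + (t : ℝ)) * polyaForecast y t = 1 + trueCount y t := by
  rw [polyaForecast]
  have : (2 + (t : ℝ)) ≠ 0 := by positivity
  field_simp

theorem polyaUrn_true (y : ℕ → Bool) (t : ℕ) :
    (polyaUrn t (fun s : Fin t => y s) true).toReal = polyaForecast y t := by
  have h : ((Finset.univ.filter fun s : Fin t => y s = true).card : ℝ) = trueCount y t := by
    rw [trueCount, ← Fin.sum_univ_eq_sum_range (fun s => boolReal (y s)), Finset.card_filter]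
    push_cast
    rfl
  simp only [polyaUrn, PMF.ofFintype_apply, polyaForecast, ENNReal.toReal_div,
    ENNReal.toReal_natCast, Fintype.card_bool]
  push_cast
  rw [h]

namespace SmoothConvex

variable {G D : ℝ → ℝ} {K : ℝ} (h : SmoothConvex G D K) (y : ℕ → Bool)
include h

/-- The Polya forecast moves by `(z - p) / (t + 3)`, so multiplying the quadratic bound by `t + 3`
yields exactly the proper score of the round and an error of `K / (t + 3)`. -/
theorem polya_step (t : ℕ) :
    (2 + (t + 1 : ℕ)) * G (polyaForecast y (t + 1)) ≤ (2 + t) * G (polyaForecast y t) +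
      (G (polyaForecast y t) + (boolReal (y t) - polyaForecast y t) * D (polyaForecast y t)) +
      K * (1 / (t + 3)) := by
  have hK := h.nonneg
  have e1 := polyaForecast_mul y t
  have e2 := polyaForecast_mul y (t + 1)
  have e3 : trueCount y (t + 1) = trueCount y t + boolReal (y t) := Finset.sum_range_succ _ _
  have hp0 := polyaForecast_nonneg y t
  have hp1 := polyaForecast_le_one y t
  have hy0 := boolReal_nonneg (y t)
  have hy1 := boolReal_le_one (y t)
  set p := polyaForecast y t
  set q := polyaForecast y (t + 1)
  set z := boolReal (y t)
  push_cast at e2 ⊢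
  have hn : (0 : ℝ) < t + 3 := by positivity
  have hqp : q - p = (z - p) / (t + 3) := by
    rw [eq_div_iff hn.ne']; linarith
  have hq := mul_le_mul_of_nonneg_left (h.quadratic p q) hn.le
  have hsq : (z - p) ^ 2 ≤ 1 := by
    rw [sq_le_one_iff_abs_le_one]; exact abs_le.2 ⟨by linarith, by linarith⟩
  have e4 : (t + 3) * (G p + (q - p) * D p + K * (q - p) ^ 2) =
      (t + 3) * G p + (z - p) * D p + K * ((z - p) ^ 2 * (1 / (t + 3))) := by
    rw [hqp]; field_simp
  have e5 : K * ((z - p) ^ 2 * (1 / (t + 3))) ≤ K * (1 / (t + 3)) :=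
    mul_le_mul_of_nonneg_left (mul_le_of_le_one_left (by positivity) hsq) hK
  linarith

/-- Jensen: the new forecast averages the old one, with weight `2 + t`, and the new state, with
weight 1. This makes no reference to the forecast actually played. -/
theorem polya_step_le (t : ℕ) :
    (2 + (t + 1 : ℕ)) * G (polyaForecast y (t + 1)) ≤ (2 + t) * G (polyaForecast y t) +
      G (boolReal (y t)) := by
  have e1 := polyaForecast_mul y t
  have e2 := polyaForecast_mul y (t + 1)
  have e3 : trueCount y (t + 1) = trueCount y t + boolReal (y t) := Finset.sum_range_succ _ _
  set p := polyaForecast y t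
  set q := polyaForecast y (t + 1)
  set z := boolReal (y t)
  push_cast at e2 ⊢
  have h1 := mul_le_mul_of_nonneg_left (h.tangent q p) (by positivity : (0 : ℝ) ≤ 2 + t)
  have h2 := h.tangent q z
  have h3 : (2 + (t : ℝ)) * (G q + (p - q) * D q) + (G q + (z - q) * D q) =
      (2 + (t + 1)) * G q := by
    have : (2 + (t : ℝ)) * (p - q) + (z - q) = 0 := by linarith
    linear_combination this * D q
  linarith

/-- Jensen again: the Polya forecast averages the `t` observations and two pseudo-observations of
mean `1 / 2`. -/
theorem polya_le_mean {t : ℕ} (ht : 1 ≤ t) :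
    (2 + (t : ℝ)) * G (polyaForecast y t) ≤ t * G (trueCount y t / t) + 2 * G (1 / 2) := by
  have ht' : (0 : ℝ) < t := by exact_mod_cast ht
  have e1 := polyaForecast_mul y t
  have e2 : (t : ℝ) * (trueCount y t / t) = trueCount y t := by field_simp
  set p := polyaForecast y t
  set q := trueCount y t / t
  have h1 := mul_le_mul_of_nonneg_left (h.tangent p q) ht'.le
  have h2 := h.tangent p (1 / 2)
  have h3 : (t : ℝ) * (G p + (q - p) * D p) + 2 * (G p + (1 / 2 - p) * D p) =
      (2 + t) * G p := by
    have : (t : ℝ) * (q - p) + 2 * (1 / 2 - p) = 0 := by linarith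
    linear_combination this * D p
  linarith

end SmoothConvex

theorem sum_one_div_add_three_le (T : ℕ) :
    ∑ s ∈ Finset.range T, (1 / ((s : ℝ) + 3)) ≤ Real.log (T + 2) := by
  induction T with
  | zero => simpa using Real.log_nonneg (by norm_num : (1 : ℝ) ≤ 2)
  | succ n ih =>
    rw [Finset.sum_range_succ]
    have h1 := Real.one_sub_inv_le_log_of_pos (x := ((n : ℝ) + 3) / (n + 2)) (by positivity)
    rw [Real.log_div (by positivity) (by positivity)] at h1
    have h2 : 1 - (((n : ℝ) + 3) / (n + 2))⁻¹ = 1 / (n + 3) := by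
      rw [inv_div]
      field_simp
      ring
    have h3 : ((n + 1 : ℕ) : ℝ) + 2 = n + 3 := by push_cast; ring
    rw [h3]
    linarith

/-! ### Regret of the switching algorithm -/

theorem softMax_smoothConvex {A : Type*} [Fintype A] [Nonempty A] {U : A → Bool → ℝ}
    (hU : ∀ a y, |U a y| ≤ 1) {η : ℝ} (hη : 0 < η) :
    SmoothConvex (softMax U η) (softSlope U η) (8 / η) where
  tangent p q := softMax_tangent U p q hη
  quadratic p q := softMax_le_quadratic p q hU hη
  slope_le p := abs_softSlope_le p hU

section Switching

variable {c : ℝ} {m : ℕ} {δ : ℝ} {M₀ : NextTokenModel Bool} {y : ℕ → Bool}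

theorem HasSwitched.mono {s t : ℕ} (hst : s ≤ t)
    (h : HasSwitched c m δ M₀ (fun r : Fin s => y r)) :
    HasSwitched c m δ M₀ (fun r : Fin t => y r) := by
  obtain ⟨r, hr, h1, h2⟩ := h
  exact ⟨r, hr.trans hst, h1, h2⟩

theorem switchModel_of_switched {n : ℕ} {y : Fin n → Bool} (h : HasSwitched c m δ M₀ y) :
    switchModel c m δ M₀ n y = polyaUrn n y := if_pos h

theorem switchModel_of_not_switched {n : ℕ} {y : Fin n → Bool} (h : ¬HasSwitched c m δ M₀ y) :
    switchModel c m δ M₀ n y = M₀ n y := if_neg h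

theorem not_hasSwitched_zero {y : Fin 0 → Bool} : ¬HasSwitched c m δ M₀ y := by
  rintro ⟨s, hs, h1, _⟩
  omega

theorem scoreRegret_le_of_not_switched {t : ℕ} (ht : 1 ≤ t)
    (h : ¬HasSwitched c m δ M₀ (fun r : Fin t => y r)) {v : ℝ} (hv : v ∈ tipGrid m) :
    scoreRegret (vScore v) (forecasts M₀ fun r : Fin t => y r) (fun r : Fin t => y r) ≤
      vThreshold c m δ t := by
  have h1 : vGap m M₀ (fun r : Fin t => y r) ≤ vThreshold c m δ t := by
    by_contra hlt
    exact h ⟨t, le_rfl, ht, not_le.1 hlt⟩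
  exact (Finset.le_sup' (fun v => scoreRegret (vScore v)
    (forecasts M₀ fun r : Fin t => y r) (fun r : Fin t => y r)) hv).trans h1

variable {A : Type*} [Fintype A] [Nonempty A] {U : A → Bool → ℝ}

/-- Forecast of the state `true` in round `t` by the switching algorithm. -/
noncomputable def switchForecast (c : ℝ) (m : ℕ) (δ : ℝ) (M₀ : NextTokenModel Bool)
    (y : ℕ → Bool) (t : ℕ) : ℝ :=
  (switchModel c m δ M₀ t (fun r : Fin t => y r) true).toReal

theorem potential_le_of_not_switched (hc : 0 ≤ c) (hm : 0 < m) (hU : ∀ a y, |U a y| ≤ 1)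
    {η : ℝ} (hη : 0 < η) {t : ℕ} (ht : 1 ≤ t)
    (h : ¬HasSwitched c m δ M₀ (fun r : Fin t => y r)) :
    (2 + (t : ℝ)) * softMax U η (polyaForecast y t) -
      ∑ s ∈ Finset.range t, ∑ b, qbrAt U η (switchForecast c m δ M₀ y s) b * U b (y s) ≤
      2 * (1 + η * Real.log (Fintype.card A)) + 2 * (t * vThreshold c m δ t) +
        t * (8 * (8 / η) / m + η * Real.log (Fintype.card A)) := by
  have hG := softMax_smoothConvex hU hη
  have hthr : 0 ≤ vThreshold c m δ t := mul_nonneg hc (Real.sqrt_nonneg _)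
  have h1 := hG.mul_mean_le hm ht (forecasts M₀ fun r : Fin t => y r)
    (fun _ => ENNReal.toReal_nonneg) (fun _ => pmf_toReal_le_one _ _) (fun r : Fin t => y r) hthr
    fun v hv => scoreRegret_le_of_not_switched ht h hv
  have h2 := hG.polya_le_mean y ht
  have h3 := softMax_le (1 / 2) hU hη (by norm_num) (by norm_num)
  have hf : ∀ s : Fin t, forecasts M₀ (fun r : Fin t => y r) s = switchForecast c m δ M₀ y s := by
    intro s
    rw [switchForecast,
      switchModel_of_not_switched fun hs => h (HasSwitched.mono s.isLt.le hs)]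
    rfl
  have h4 : ∑ s : Fin t, (softMax U η (forecasts M₀ (fun r : Fin t => y r) s) +
      (boolReal (y s) - forecasts M₀ (fun r : Fin t => y r) s) *
        softSlope U η (forecasts M₀ (fun r : Fin t => y r) s)) -
      t * (η * Real.log (Fintype.card A)) ≤
      ∑ s ∈ Finset.range t, ∑ b, qbrAt U η (switchForecast c m δ M₀ y s) b * U b (y s) := by
    rw [← Fin.sum_univ_eq_sum_range
      (fun s => ∑ b, qbrAt U η (switchForecast c m δ M₀ y s) b * U b (y s))]
    have : (t : ℝ) * (η * Real.log (Fintype.card A)) =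
      ∑ _s : Fin t, η * Real.log (Fintype.card A) := by simp
    rw [this, ← Finset.sum_sub_distrib]
    refine Finset.sum_le_sum fun s _ => ?_
    rw [hf]
    exact softMax_sub_entropy_le _ hη _
  have h5 : trueCount y t = ∑ s : Fin t, boolReal (y s) :=
    (Fin.sum_univ_eq_sum_range (fun s => boolReal (y s)) t).symm
  rw [h5] at h2
  linarith

theorem potential_le (hc : 0 ≤ c) (hm : 0 < m) (hU : ∀ a y, |U a y| ≤ 1)
    {η : ℝ} (hη : 0 < η) {B : ℝ} (hB0 : 0 ≤ B)
    {T : ℕ} (hB : ∀ t : ℕ, 1 ≤ t → t ≤ T → t * vThreshold c m δ t ≤ B) :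
    (2 + (T : ℝ)) * softMax U η (polyaForecast y T) -
      ∑ s ∈ Finset.range T, ∑ b, qbrAt U η (switchForecast c m δ M₀ y s) b * U b (y s) ≤
      4 + 3 * (η * Real.log (Fintype.card A)) + 2 * B +
        T * (8 * (8 / η) / m + η * Real.log (Fintype.card A)) +
        8 / η * Real.log (T + 2) := by
  classical
  have hG := softMax_smoothConvex hU hη
  set E := η * Real.log (Fintype.card A) with hE
  have hE0 : 0 ≤ E := mul_nonneg hη.le (Real.log_natCast_nonneg _)
  have hK := hG.nonneg
  set u : ℕ → ℝ := fun s => ∑ b, qbrAt U η (switchForecast c m δ M₀ y s) b * U b (y s) with hu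
  have hmp : (0 : ℝ) < m := by exact_mod_cast hm
  have hQ : 0 ≤ 8 * (8 / η) / m := by positivity
  -- The indicator pays once for the round whose outcome triggers the switch.
  have key : ∀ t : ℕ, t ≤ T →
      (2 + (t : ℝ)) * softMax U η (polyaForecast y t) - ∑ s ∈ Finset.range t, u s ≤
      2 * (1 + E) + 2 * B + t * (8 * (8 / η) / m + E) +
        8 / η * ∑ s ∈ Finset.range t, (1 / ((s : ℝ) + 3)) +
        (if HasSwitched c m δ M₀ (fun r : Fin t => y r) then 2 + E else 0) := by
    intro t
    induction t with
    | zero =>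
      intro _
      rw [if_neg not_hasSwitched_zero]
      have h0 : polyaForecast y 0 = 1 / 2 := by simp [polyaForecast, trueCount]
      have h3 := softMax_le (1 / 2) hU hη (by norm_num) (by norm_num)
      rw [h0]
      simp only [CharP.cast_eq_zero, Finset.range_zero, Finset.sum_empty]
      linarith
    | succ t ih =>
      intro ht
      have ih := ih (by omega)
      have hS : 0 ≤ 8 / η * ∑ s ∈ Finset.range (t + 1), (1 / ((s : ℝ) + 3)) :=
        mul_nonneg hK (Finset.sum_nonneg fun _ _ => by positivity)
      have hS1 : 8 / η * ∑ s ∈ Finset.range (t + 1), (1 / ((s : ℝ) + 3)) =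
          8 / η * ∑ s ∈ Finset.range t, (1 / ((s : ℝ) + 3)) + 8 / η * (1 / ((t : ℝ) + 3)) := by
        rw [Finset.sum_range_succ, mul_add]
      have hS2 : 0 ≤ 8 / η * (1 / ((t : ℝ) + 3)) := mul_nonneg hK (by positivity)
      have ht1 : ((t + 1 : ℕ) : ℝ) * (8 * (8 / η) / m + E) =
          t * (8 * (8 / η) / m + E) + (8 * (8 / η) / m + E) := by push_cast; ring
      by_cases h1 : HasSwitched c m δ M₀ (fun r : Fin (t + 1) => y r)
      · rw [if_pos h1, Finset.sum_range_succ u]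
        by_cases h0 : HasSwitched c m δ M₀ (fun r : Fin t => y r)
        · rw [if_pos h0] at ih
          have hf : switchForecast c m δ M₀ y t = polyaForecast y t := by
            rw [switchForecast, switchModel_of_switched h0, polyaUrn_true]
          have s1 := hG.polya_step y t
          have s2 : _ ≤ u t := softMax_sub_entropy_le (switchForecast c m δ M₀ y t) hη (y t)
          rw [hf] at s2
          linarith
        -- The switch is detected after this round, which `M₀` still forecast: utility is at least
        -- `-1` and `G` at the state at most `1 + E`.
        · rw [if_neg h0] at ih
          have s1 := hG.polya_step_le y t
          have s2 := softMax_le _ hU hη (boolReal_nonneg (y t)) (boolReal_le_one (y t))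
          have s3 : -1 ≤ u t := neg_one_le_qbr_utility _ hU _
          linarith
      -- Without a switch the induction hypothesis is not used; the test itself bounds the
      -- potential.
      · rw [if_neg h1]
        have := potential_le_of_not_switched hc hm hU hη (by omega) h1
        have hb := hB (t + 1) (by omega) ht
        linarith
  have h1 := key T le_rfl
  have h2 : (if HasSwitched c m δ M₀ (fun r : Fin T => y r) then 2 + E else 0) ≤ 2 + E := by
    split_ifs <;> linarith
  have h3 := mul_le_mul_of_nonneg_left (sum_one_div_add_three_le T) hK
  linarith

/-- The potential dominates the total utility of `a` over the true rounds and the two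
pseudo-observations; the latter cost at most 2. -/
theorem regret_sum_le (hc : 0 ≤ c) (hm : 0 < m) (hU : ∀ a y, |U a y| ≤ 1)
    {η : ℝ} (hη : 0 < η) {B : ℝ} (hB0 : 0 ≤ B)
    {T : ℕ} (hB : ∀ t : ℕ, 1 ≤ t → t ≤ T → t * vThreshold c m δ t ≤ B) (a : A) :
    ∑ s ∈ Finset.range T,
      (U a (y s) - ∑ b, qbrAt U η (switchForecast c m δ M₀ y s) b * U b (y s)) ≤
      6 + 3 * (η * Real.log (Fintype.card A)) + 2 * B +
        T * (8 * (8 / η) / m + η * Real.log (Fintype.card A)) +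
        8 / η * Real.log (T + 2) := by
  have h1 := potential_le (M₀ := M₀) (y := y) hc hm hU hη hB0 hB
  have h2 := mul_le_mul_of_nonneg_left (linUtil_le_softMax (U := U) (polyaForecast y T) hη a)
    (by positivity : (0 : ℝ) ≤ 2 + T)
  have h3 : (2 + (T : ℝ)) * linUtil U a (polyaForecast y T) =
      U a false + U a true + ∑ s ∈ Finset.range T, U a (y s) := by
    have hs : ∑ s ∈ Finset.range T, U a (y s) =
        T * U a false + trueCount y T * (U a true - U a false) := by
      rw [trueCount, Finset.sum_mul]
      have : (T : ℝ) * U a false = ∑ _s ∈ Finset.range T, U a false := by simp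
      rw [this, ← Finset.sum_add_distrib]
      refine Finset.sum_congr rfl fun s _ => ?_
      cases y s <;> simp [boolReal]
    rw [hs, linUtil]
    linear_combination (U a true - U a false) * polyaForecast_mul y T
  have h4 := (abs_le.1 (hU a false)).1
  have h5 := (abs_le.1 (hU a true)).1
  rw [Finset.sum_sub_distrib]
  linarith

end Switching

/-! ### Total variation distance of the switching algorithm from the primary model -/

/-- The supermartingale inequality in elementary form: the last coordinate is summed out first. -/
theorem sum_prod_le_one {Θ : Type*} [Fintype Θ] (w : (n : ℕ) → (Fin n → Θ) → Θ → ℝ)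
    (h0 : ∀ n h x, 0 ≤ w n h x) (h1 : ∀ n h, ∑ x, w n h x ≤ 1) (T : ℕ) :
    ∑ θ : Fin T → Θ, ∏ t : Fin T, w t.val (past θ t) (θ t) ≤ 1 := by
  induction T with
  | zero => simp
  | succ n ih =>
    rw [← (Fin.snocEquiv (fun _ : Fin (n + 1) => Θ)).sum_comp, Fintype.sum_prod_type_right]
    have key : ∀ (θ : Fin n → Θ) (x : Θ),
        (∏ t : Fin (n + 1), w t.val
          (past ((Fin.snocEquiv (fun _ : Fin (n + 1) => Θ)) (x, θ)) t)
          ((Fin.snocEquiv (fun _ : Fin (n + 1) => Θ)) (x, θ) t))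
        = (∏ t : Fin n, w t.val (past θ t) (θ t)) * w n θ x := by
      intro θ x
      rw [Fin.prod_univ_castSucc]
      congr 1
      · refine Finset.prod_congr rfl fun t _ => ?_
        have h1 : past ((Fin.snocEquiv (fun _ : Fin (n + 1) => Θ)) (x, θ)) t.castSucc
            = past θ t := by
          funext s
          exact Fin.snoc_castSucc (α := fun _ : Fin (n + 1) => Θ) x θ (Fin.castLE t.isLt.le s)
        have h2 : (Fin.snocEquiv (fun _ : Fin (n + 1) => Θ)) (x, θ) t.castSucc = θ t :=
          Fin.snoc_castSucc (α := fun _ : Fin (n + 1) => Θ) x θ t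
        rw [h2]
        exact congrArg (fun h => w t.val h (θ t)) h1
      · have h1 : past ((Fin.snocEquiv (fun _ : Fin (n + 1) => Θ)) (x, θ)) (Fin.last n)
            = θ := by
          funext s
          exact Fin.snoc_castSucc (α := fun _ : Fin (n + 1) => Θ) x θ s
        have h2 : (Fin.snocEquiv (fun _ : Fin (n + 1) => Θ)) (x, θ) (Fin.last n) = x :=
          Fin.snoc_last (α := fun _ : Fin (n + 1) => Θ) x θ
        rw [h2]
        exact congrArg (fun h => w n h x) h1
    simp_rw [key, ← Finset.mul_sum]
    refine (Finset.sum_le_sum fun θ _ => ?_).trans ih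
    exact mul_le_of_le_one_right (Finset.prod_nonneg fun _ _ => h0 _ _ _) (h1 n θ)

theorem inducedDist_toReal {Θ : Type*} [Fintype Θ] (M : NextTokenModel Θ) (T : ℕ)
    (θ : Fin T → Θ) :
    (inducedDist M T θ).toReal = ∏ t : Fin T, (M t.val (past θ t) (θ t)).toReal := by
  simp only [inducedDist, PMF.ofFintype_apply, ENNReal.toReal_prod]

theorem sum_toReal_pmf {Ω : Type*} [Fintype Ω] (P : PMF Ω) : ∑ ω, (P ω).toReal = 1 := by
  have h := P.tsum_coe
  rw [tsum_fintype] at h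
  rw [← ENNReal.toReal_sum fun ω _ => P.apply_ne_top ω, h, ENNReal.toReal_one]

theorem tvDist_le_of_eq_off {Ω : Type*} [Fintype Ω] (P Q : PMF Ω) (B : Ω → Prop)
    [DecidablePred B] (h : ∀ ω, ¬B ω → P ω = Q ω) :
    tvDist P Q ≤ ∑ ω, if B ω then (Q ω).toReal else 0 := by
  -- The signed difference sums to zero, so only the mass of `Q` on `B` survives.
  have h1 : ∀ ω, |(P ω).toReal - (Q ω).toReal| ≤
      (P ω).toReal - (Q ω).toReal + 2 * (if B ω then (Q ω).toReal else 0) := fun ω => by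
    have hP : 0 ≤ (P ω).toReal := ENNReal.toReal_nonneg
    have hQ : 0 ≤ (Q ω).toReal := ENNReal.toReal_nonneg
    by_cases hB : B ω
    · rw [if_pos hB]
      exact abs_le.2 ⟨by linarith, by linarith⟩
    · rw [if_neg hB, h ω hB]
      simp
  have h2 := Finset.sum_le_sum fun ω (_ : ω ∈ Finset.univ) => h1 ω
  rw [Finset.sum_add_distrib, Finset.sum_sub_distrib, sum_toReal_pmf, sum_toReal_pmf,
    ← Finset.mul_sum] at h2
  rw [tvDist]
  linarith

/-- A finite binary sequence extended by `false`. -/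
def seqExt {T : ℕ} (θ : Fin T → Bool) (n : ℕ) : Bool := if h : n < T then θ ⟨n, h⟩ else false

theorem seqExt_val {T : ℕ} (θ : Fin T → Bool) : (fun t : Fin T => seqExt θ t) = θ := by
  funext t
  simp [seqExt]

/-- Payoff in round `r` of a bet against the forecast of the model `M`. -/
noncomputable def forecastBet (M : NextTokenModel Bool) (v e : ℝ) (y : ℕ → Bool) (r : ℕ) : ℝ :=
  (boolReal (y r) - v) * (Real.sign (v - (M r (fun i : Fin r => y i) true).toReal) + e)

/-- A constant forecast has total loss `Z * sign (v - q) ≥ -|Z|`, so the total regret is at most the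
bet with `e = 0` plus `|Z|`. Choosing `e` as the sign of `Z` merges the two. -/
theorem exists_bet_of_lt_vGap {m : ℕ} {M : NextTokenModel Bool} {y : ℕ → Bool} {s : ℕ}
    (hs : 1 ≤ s) {b : ℝ} (h : b < vGap m M (fun r : Fin s => y r)) :
    ∃ v ∈ tipGrid m, ∃ e ∈ ({1, -1} : Finset ℝ),
      s * b < ∑ r ∈ Finset.range s, forecastBet M v e y r := by
  have hs' : (0 : ℝ) < s := by exact_mod_cast hs
  obtain ⟨v, hv, hlt⟩ := (Finset.lt_sup'_iff _).1 h
  refine ⟨v, hv, ?_⟩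
  set Z := ∑ r ∈ Finset.range s, (boolReal (y r) - v) with hZ
  have hZ' : ∑ r : Fin s, (boolReal (y r) - v) = Z :=
    Fin.sum_univ_eq_sum_range (fun r => boolReal (y r) - v) s
  have hinf : -(|Z| / s) ≤ ⨅ q : unitInterval,
      (1 / (s : ℝ)) * ∑ t : Fin s, vScore v (q : ℝ) (y t) := by
    refine le_ciInf fun q => ?_
    have h1 : ∑ t : Fin s, vScore v (q : ℝ) (y t) = Z * Real.sign (v - q) := by
      simp only [vScore_eq]
      rw [← Finset.sum_mul, hZ']
    have h2 : |Z * Real.sign (v - q)| ≤ |Z| := by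
      rw [abs_mul]
      exact mul_le_of_le_one_right (abs_nonneg _) (abs_sign_le_one _)
    rw [h1, ← neg_div, one_div_mul_eq_div]
    exact div_le_div_of_nonneg_right (by linarith [(abs_le.1 h2).1]) hs'.le
  have hsum : ∑ t : Fin s, vScore v (forecasts M (fun r : Fin s => y r) t) (y t) =
      ∑ r ∈ Finset.range s, forecastBet M v 0 y r := by
    rw [← Fin.sum_univ_eq_sum_range]
    refine Finset.sum_congr rfl fun t _ => ?_
    rw [vScore_eq, forecastBet, add_zero]
    rfl
  have hmain : s * b < ∑ r ∈ Finset.range s, forecastBet M v 0 y r + |Z| := by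
    rw [scoreRegret, hsum] at hlt
    have : b < (1 / (s : ℝ)) * ∑ r ∈ Finset.range s, forecastBet M v 0 y r + |Z| / s := by
      linarith
    rw [one_div_mul_eq_div, ← add_div, lt_div_iff₀ hs'] at this
    linarith
  have hsplit : ∀ e : ℝ, ∑ r ∈ Finset.range s, forecastBet M v e y r =
      ∑ r ∈ Finset.range s, forecastBet M v 0 y r + Z * e := fun e => by
    rw [hZ, Finset.sum_mul, ← Finset.sum_add_distrib]
    refine Finset.sum_congr rfl fun r _ => ?_
    rw [forecastBet, forecastBet]
    ring
  rcases abs_cases Z with hc | hc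
  · exact ⟨1, by simp, by rw [hsplit]; linarith⟩
  · exact ⟨-1, by simp, by rw [hsplit]; linarith⟩

theorem abs_forecastBet_le (M : NextTokenModel Bool) {v e : ℝ} (h0 : 0 ≤ v) (h1 : v ≤ 1)
    (he : |e| ≤ 1) (y : ℕ → Bool) (r : ℕ) : |forecastBet M v e y r| ≤ 2 := by
  rw [forecastBet, abs_mul]
  have a1 := abs_boolReal_sub_le h0 h1 (y r)
  have a2 := (abs_add_le (Real.sign (v - (M r (fun i : Fin r => y i) true).toReal)) e).trans
    (add_le_add (abs_sign_le_one _) he)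
  calc _ ≤ 1 * (1 + 1 : ℝ) := mul_le_mul a1 a2 (abs_nonneg _) zero_le_one
    _ = 2 := by norm_num

theorem expected_exp_bet_le (μ : PMF Bool) {v e l : ℝ} (h0 : 0 ≤ v) (h1 : v ≤ 1)
    (he : |e| ≤ 1) (hl0 : 0 ≤ l) (hl : 2 * l ≤ 1) :
    ∑ x, (μ x).toReal * Real.exp (l * ((boolReal x - v) *
      (Real.sign (v - (μ true).toReal) + e)) - 4 * l ^ 2) ≤ 1 := by
  set p := (μ true).toReal with hp
  set g := Real.sign (v - p) + e with hg
  have hgabs : |g| ≤ 2 := (abs_add_le _ _).trans (by linarith [abs_sign_le_one (v - p)])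
  have hx : ∀ x, Real.exp (l * ((boolReal x - v) * g)) ≤
      1 + l * ((boolReal x - v) * g) + 4 * l ^ 2 := fun x => by
    have hX : |(boolReal x - v) * g| ≤ 2 := by
      rw [abs_mul]
      calc _ ≤ 1 * (2 : ℝ) :=
            mul_le_mul (abs_boolReal_sub_le h0 h1 x) hgabs (abs_nonneg _) zero_le_one
        _ = 2 := by norm_num
    have hlX : |l * ((boolReal x - v) * g)| ≤ 1 := by
      rw [abs_mul, abs_of_nonneg hl0]
      nlinarith
    have e1 := (abs_le.1 (Real.abs_exp_sub_one_sub_id_le hlX)).2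
    have e2 : ((boolReal x - v) * g) ^ 2 ≤ 4 := by
      rw [← sq_abs]; nlinarith [abs_nonneg ((boolReal x - v) * g)]
    have e3 : (l * ((boolReal x - v) * g)) ^ 2 ≤ 4 * l ^ 2 := by
      rw [mul_pow]; nlinarith [sq_nonneg l]
    linarith
  -- The sign term contributes `-|p - v|`, which outweighs `e * (p - v)`.
  have hmean : (p - v) * g ≤ 0 := by
    have e1 := abs_le.1 he
    rw [hg]
    rcases lt_trichotomy (v - p) 0 with h | h | h
    · rw [Real.sign_of_neg h]; nlinarith
    · have : p - v = 0 := by linarith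
      rw [this, zero_mul]
    · rw [Real.sign_of_pos h]; nlinarith
  have hpos : 0 < Real.exp (4 * l ^ 2) := Real.exp_pos _
  have hexp := Real.add_one_le_exp (4 * l ^ 2)
  simp only [Real.exp_sub, ← mul_div_assoc]
  rw [← Finset.sum_div, div_le_one hpos]
  refine le_trans (Finset.sum_le_sum fun x _ =>
    mul_le_mul_of_nonneg_left (hx x) ENNReal.toReal_nonneg) ?_
  rw [Fintype.sum_bool, pmf_bool_false μ, ← hp]
  have e0 : boolReal true = 1 := rfl
  have e1 : boolReal false = 0 := rfl
  rw [e0, e1]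
  have e2 : p * (1 + l * ((1 - v) * g) + 4 * l ^ 2) +
      (1 - p) * (1 + l * ((0 - v) * g) + 4 * l ^ 2) = 1 + 4 * l ^ 2 + l * ((p - v) * g) := by
    ring
  rw [e2]
  have := mul_nonpos_of_nonneg_of_nonpos hl0 hmean
  linarith

/-- Azuma–Hoeffding by the exponential method: the likelihood is reweighted by the bet's exponential
during the first `s` rounds only. -/
theorem prob_bet_gt_le (M : NextTokenModel Bool) {v e b : ℝ} (h0 : 0 ≤ v) (h1 : v ≤ 1)
    (he : |e| ≤ 1) (hb : 0 ≤ b) {s T : ℕ} (hs : 1 ≤ s) (hsT : s ≤ T) :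
    (∑ θ : Fin T → Bool, if s * b < ∑ r ∈ Finset.range s, forecastBet M v e (seqExt θ) r
      then (inducedDist M T θ).toReal else 0) ≤ Real.exp (-(s * b ^ 2 / 16)) := by
  have hs' : (0 : ℝ) < s := by exact_mod_cast hs
  -- Payoffs are at most 2, so for `b > 4` the event is empty; otherwise `2 * l ≤ 1` holds below.
  rcases lt_or_ge 4 b with hb4 | hb4
  · rw [Finset.sum_eq_zero]
    · exact (Real.exp_pos _).le
    · intro θ _
      rw [if_neg]
      rw [not_lt]
      calc _ ≤ ∑ _r ∈ Finset.range s, (2 : ℝ) := Finset.sum_le_sum fun r _ =>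
            (abs_le.1 (abs_forecastBet_le M h0 h1 he _ r)).2
        _ = s * 2 := by simp
        _ ≤ s * b := mul_le_mul_of_nonneg_left (by linarith) hs'.le
  -- Minimizes `4 * l ^ 2 - l * b`, with value `-b ^ 2 / 16`.
  set l := b / 8 with hl
  set w : (n : ℕ) → (Fin n → Bool) → Bool → ℝ := fun n h x => (M n h x).toReal *
    (if n < s then Real.exp (l * ((boolReal x - v) *
      (Real.sign (v - (M n h true).toReal) + e)) - 4 * l ^ 2) else 1) with hw
  have hw0 : ∀ n h x, 0 ≤ w n h x := fun n h x => by
    refine mul_nonneg ENNReal.toReal_nonneg ?_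
    split_ifs
    · exact (Real.exp_pos _).le
    · exact zero_le_one
  have hw1 : ∀ n h, ∑ x, w n h x ≤ 1 := fun n h => by
    by_cases hn : n < s
    · simp only [hw, if_pos hn]
      exact expected_exp_bet_le (M n h) h0 h1 he (by positivity) (by linarith)
    · simp only [hw, if_neg hn, mul_one]
      exact (sum_toReal_pmf _).le
  have hprod : ∀ θ : Fin T → Bool, ∏ t : Fin T, w t.val (past θ t) (θ t) =
      (inducedDist M T θ).toReal *
        Real.exp (l * ∑ r ∈ Finset.range s, forecastBet M v e (seqExt θ) r - 4 * l ^ 2 * s) := by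
    intro θ
    have hθ := seqExt_val θ
    set y := seqExt θ
    rw [← hθ]
    rw [inducedDist_toReal, hw, Finset.prod_mul_distrib]
    congr 1
    have := Fin.prod_univ_eq_prod_range (fun n => if n < s then
      Real.exp (l * forecastBet M v e y n - 4 * l ^ 2) else 1) T
    refine this.trans ?_
    rw [← Finset.prod_filter]
    have hfil : (Finset.range T).filter (fun n => n < s) = Finset.range s := by
      ext n
      simp only [Finset.mem_filter, Finset.mem_range]
      omega
    rw [hfil, ← Real.exp_sum, Finset.sum_sub_distrib, ← Finset.mul_sum]
    simp only [Finset.sum_const, Finset.card_range, nsmul_eq_mul]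
    rw [mul_comm (s : ℝ)]
  have hterm : ∀ θ : Fin T → Bool,
      (if s * b < ∑ r ∈ Finset.range s, forecastBet M v e (seqExt θ) r
        then (inducedDist M T θ).toReal else 0) ≤
      (∏ t : Fin T, w t.val (past θ t) (θ t)) * Real.exp (-(s * b ^ 2 / 16)) := fun θ => by
    split_ifs with hlt
    · rw [hprod, mul_assoc, ← Real.exp_add]
      refine le_mul_of_one_le_right ENNReal.toReal_nonneg (Real.one_le_exp ?_)
      have e1 := mul_le_mul_of_nonneg_left hlt.le (by positivity : 0 ≤ l)
      have e2 : l * (s * b) - 4 * l ^ 2 * s + -(s * b ^ 2 / 16) = 0 := by rw [hl]; ring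
      linarith
    · exact mul_nonneg (Finset.prod_nonneg fun _ _ => hw0 _ _ _) (Real.exp_pos _).le
  calc _ ≤ ∑ θ : Fin T → Bool,
        (∏ t : Fin T, w t.val (past θ t) (θ t)) * Real.exp (-(s * b ^ 2 / 16)) :=
        Finset.sum_le_sum fun θ _ => hterm θ
    _ = (∑ θ : Fin T → Bool, ∏ t : Fin T, w t.val (past θ t) (θ t)) *
        Real.exp (-(s * b ^ 2 / 16)) := by rw [Finset.sum_mul]
    _ ≤ _ := mul_le_of_le_one_left (Real.exp_pos _).le (sum_prod_le_one w hw0 hw1 T)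

theorem inducedDist_switchModel_eq {c : ℝ} {m : ℕ} {δ : ℝ} {M₀ : NextTokenModel Bool} {T : ℕ}
    (hT : 1 ≤ T) (y : ℕ → Bool) (h : ¬HasSwitched c m δ M₀ (fun r : Fin (T - 1) => y r)) :
    inducedDist (switchModel c m δ M₀) T (fun t => y t) = inducedDist M₀ T (fun t => y t) := by
  simp only [inducedDist, PMF.ofFintype_apply]
  refine Finset.prod_congr rfl fun t _ => ?_
  have : ¬HasSwitched c m δ M₀ (past (fun t : Fin T => y t) t) := fun hs =>
    h (HasSwitched.mono (y := y) (by omega : t.val ≤ T - 1) hs)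
  rw [switchModel_of_not_switched this]

theorem tvDist_switchModel_le {c : ℝ} {m : ℕ} {δ : ℝ} {M₀ : NextTokenModel Bool} {T : ℕ}
    (hc : 0 ≤ c) (hT : 1 ≤ T) {ρ : ℝ}
    (hρ : ∀ s : ℕ, 1 ≤ s → s < T → Real.exp (-(s * vThreshold c m δ s ^ 2 / 16)) ≤ ρ) :
    tvDist (inducedDist (switchModel c m δ M₀) T) (inducedDist M₀ T) ≤
      ((T - 1 : ℕ) * ((tipGrid m).card * 2)) * ρ := by
  classical
  -- Test times stop at `T - 1`, since the last forecast sees only `T - 1` states.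
  set I := Finset.Ico 1 T ×ˢ tipGrid m ×ˢ ({1, -1} : Finset ℝ) with hI
  set Ev : ℕ × ℝ × ℝ → (Fin T → Bool) → Prop := fun i θ => i.1 * vThreshold c m δ i.1 <
    ∑ r ∈ Finset.range i.1, forecastBet M₀ i.2.1 i.2.2 (seqExt θ) r with hEv
  have hcard : (I.card : ℝ) = (T - 1 : ℕ) * ((tipGrid m).card * 2) := by
    have h2 : ({1, -1} : Finset ℝ).card = 2 := Finset.card_pair (by norm_num)
    rw [hI, Finset.card_product, Finset.card_product, Nat.card_Ico, h2]
    push_cast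
    rfl
  calc _ ≤ ∑ θ : Fin T → Bool, if HasSwitched c m δ M₀ (fun r : Fin (T - 1) => seqExt θ r)
          then (inducedDist M₀ T θ).toReal else 0 := by
        refine tvDist_le_of_eq_off _ _ _ fun θ hθ => ?_
        have := inducedDist_switchModel_eq hT (seqExt θ) hθ
        rwa [seqExt_val] at this
    _ ≤ ∑ θ : Fin T → Bool, ∑ i ∈ I, if Ev i θ then (inducedDist M₀ T θ).toReal else 0 := by
        refine Finset.sum_le_sum fun θ _ => ?_
        have hnn : ∀ i ∈ I, 0 ≤ if Ev i θ then (inducedDist M₀ T θ).toReal else 0 := fun i _ => by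
          split_ifs
          · exact ENNReal.toReal_nonneg
          · exact le_rfl
        split_ifs with hsw
        · obtain ⟨s, hs, hs1, hgap⟩ := hsw
          obtain ⟨v, hv, e, he, hlt⟩ := exists_bet_of_lt_vGap (y := seqExt θ) hs1 hgap
          have hmem : (s, v, e) ∈ I := by
            rw [hI, Finset.mem_product, Finset.mem_product, Finset.mem_Ico]
            exact ⟨⟨hs1, by omega⟩, hv, he⟩
          refine le_trans (le_of_eq ?_) (Finset.single_le_sum hnn hmem)
          exact (if_pos hlt).symm
        · exact Finset.sum_nonneg hnn
    _ = ∑ i ∈ I, ∑ θ : Fin T → Bool, if Ev i θ then (inducedDist M₀ T θ).toReal else 0 :=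
        Finset.sum_comm
    _ ≤ ∑ _i ∈ I, ρ := by
        refine Finset.sum_le_sum fun i hi => ?_
        rw [hI, Finset.mem_product, Finset.mem_product, Finset.mem_Ico] at hi
        have hv := tipGrid_mem_Icc hi.2.1
        have he : |i.2.2| ≤ 1 := by
          have := hi.2.2
          rw [Finset.mem_insert, Finset.mem_singleton] at this
          rcases this with h | h <;> simp [h]
        refine le_trans ?_ (hρ i.1 hi.1.1 hi.1.2)
        exact prob_bet_gt_le M₀ hv.1 hv.2 he (mul_nonneg hc (Real.sqrt_nonneg _)) hi.1.1 hi.1.2.le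
    _ = _ := by rw [Finset.sum_const, nsmul_eq_mul, hcard]

/-! ### Size of the thresholds -/

theorem card_tipGrid_le (m : ℕ) : (tipGrid m).card ≤ m + 1 :=
  Finset.card_image_le.trans (Finset.card_range _).le

theorem one_le_card_tipGrid (m : ℕ) : (1 : ℝ) ≤ (tipGrid m).card := by
  exact_mod_cast Finset.card_pos.2 (tipGrid_nonempty m)

theorem log_threshold_arg {T t : ℕ} (hT : 1 ≤ T) (ht : 1 ≤ t) (α : ℝ) :
    Real.log (((tipGrid T).card : ℝ) * (t : ℝ) ^ 2 / (T : ℝ) ^ (-(1 + α))) =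
      Real.log (tipGrid T).card + 2 * Real.log t + (1 + α) * Real.log T := by
  have hT' : (0 : ℝ) < T := by exact_mod_cast hT
  have ht' : (0 : ℝ) < t := by exact_mod_cast ht
  have hN : (0 : ℝ) < (tipGrid T).card := zero_lt_one.trans_le (one_le_card_tipGrid T)
  rw [Real.log_div (by positivity) (Real.rpow_pos_of_pos hT' _).ne',
    Real.log_mul hN.ne' (by positivity), Real.log_pow, Real.log_rpow hT']
  push_cast
  ring

theorem vThreshold_le {α : ℝ} (hα : 0 < α) {T : ℕ} (hT : 2 ≤ T) {t : ℕ} (ht : 1 ≤ t)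
    (htT : t ≤ T) :
    vThreshold 8 T ((T : ℝ) ^ (-(1 + α))) t ≤ 24 * √((1 + α) * Real.log T / t) := by
  have hT2 : (2 : ℝ) ≤ T := by exact_mod_cast hT
  have ht' : (0 : ℝ) < t := by exact_mod_cast ht
  have htT' : (t : ℝ) ≤ T := by exact_mod_cast htT
  have hlogT : 0 ≤ Real.log T := Real.log_nonneg (by linarith)
  have hN : Real.log (tipGrid T).card ≤ 2 * Real.log T := by
    have h1 : ((tipGrid T).card : ℝ) ≤ (T : ℝ) ^ 2 := by
      have : ((tipGrid T).card : ℝ) ≤ T + 1 := by exact_mod_cast card_tipGrid_le T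
      nlinarith
    have h2 := Real.log_le_log (zero_lt_one.trans_le (one_le_card_tipGrid T)) h1
    rw [Real.log_pow] at h2
    exact_mod_cast h2
  have ht2 := Real.log_le_log ht' htT'
  have h9 : Real.log (((tipGrid T).card : ℝ) * (t : ℝ) ^ 2 / (T : ℝ) ^ (-(1 + α))) / t ≤
      3 ^ 2 * ((1 + α) * Real.log T / t) := by
    -- The three logarithms add up to at most `(5 + α) log T ≤ 9 (1 + α) log T`, whence `24 = 8 *
    -- 3`.
    rw [log_threshold_arg (by omega) ht, ← mul_div_assoc]
    refine div_le_div_of_nonneg_right ?_ ht'.le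
    nlinarith [mul_nonneg hα.le hlogT]
  rw [vThreshold]
  have h := Real.sqrt_le_sqrt h9
  rw [Real.sqrt_mul (by norm_num), Real.sqrt_sq (by norm_num)] at h
  linarith

/-- With `c = 8` the exponent is `8² / 16 = 4` times the logarithm in the threshold. This gives the
spare factor `T ^ (-4)` that absorbs the number of events in the union bound. -/
theorem exp_neg_vThreshold_le {α : ℝ} {T : ℕ} (hα : 0 < α) (hT : 1 ≤ T) {s : ℕ} (hs : 1 ≤ s) :
    Real.exp (-(s * vThreshold 8 T ((T : ℝ) ^ (-(1 + α))) s ^ 2 / 16)) ≤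
      (T : ℝ) ^ (-4 + -α) := by
  have hT' : (0 : ℝ) < T := by exact_mod_cast hT
  have hs' : (0 : ℝ) < s := by exact_mod_cast hs
  have h1 : 0 ≤ Real.log (tipGrid T).card := Real.log_nonneg (one_le_card_tipGrid T)
  have h2 : 0 ≤ Real.log s := Real.log_natCast_nonneg s
  have h3 : 0 ≤ Real.log T := Real.log_natCast_nonneg T
  have h4 := mul_nonneg hα.le h3
  rw [vThreshold, log_threshold_arg hT hs, mul_pow, Real.sq_sqrt (by
    refine div_nonneg ?_ hs'.le
    nlinarith), Real.rpow_def_of_pos hT', Real.exp_le_exp]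
  have h5 : (s : ℝ) * (8 ^ 2 * ((Real.log (tipGrid T).card + 2 * Real.log s +
      (1 + α) * Real.log T) / s)) / 16 = 4 * (Real.log (tipGrid T).card + 2 * Real.log s +
      (1 + α) * Real.log T) := by
    field_simp
    ring
  rw [h5]
  nlinarith

theorem tvDist_switchModel_le_rpow {α : ℝ} (hα : 0 < α) {T : ℕ} (hT : 1 ≤ T)
    (M₀ : NextTokenModel Bool) :
    tvDist (inducedDist (switchModel 8 T ((T : ℝ) ^ (-(1 + α))) M₀) T) (inducedDist M₀ T) ≤
      (T : ℝ) ^ (-α) := by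
  have hT' : (0 : ℝ) < T := by exact_mod_cast hT
  refine (tvDist_switchModel_le (by norm_num) hT fun s hs _ =>
    exp_neg_vThreshold_le hα hT hs).trans ?_
  have hcount : (T - 1 : ℕ) * (((tipGrid T).card : ℝ) * 2) ≤ (T : ℝ) ^ 4 := by
    rcases hT.eq_or_lt with rfl | h2
    · simp
    · have hT2 : (2 : ℝ) ≤ T := by exact_mod_cast h2
      have hN : ((tipGrid T).card : ℝ) ≤ T + 1 := by exact_mod_cast card_tipGrid_le T
      have h1 : ((T - 1 : ℕ) : ℝ) ≤ T := by exact_mod_cast Nat.sub_le T 1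
      calc _ ≤ (T : ℝ) * ((T + 1) * 2) := by gcongr
        _ ≤ T * (T * 2 * 2) := by gcongr; linarith
        _ = T ^ 2 * 2 ^ 2 := by ring
        _ ≤ T ^ 2 * T ^ 2 := by gcongr
        _ = _ := by ring
  calc _ ≤ (T : ℝ) ^ 4 * (T : ℝ) ^ (-4 + -α) :=
        mul_le_mul_of_nonneg_right hcount (Real.rpow_nonneg hT'.le _)
    _ = _ := by
        rw [← Real.rpow_natCast, ← Real.rpow_add hT']
        congr 1
        push_cast
        ring

theorem mul_vThreshold_le {α : ℝ} (hα : 0 < α) {T : ℕ} (hT : 1 ≤ T) {t : ℕ} (ht : 1 ≤ t)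
    (htT : t ≤ T) :
    t * vThreshold 8 T ((T : ℝ) ^ (-(1 + α))) t ≤
      8 + T * (24 * √((1 + α) * Real.log T / T)) := by
  have ht' : (0 : ℝ) < t := by exact_mod_cast ht
  have hT' : (0 : ℝ) < T := by exact_mod_cast hT
  have htT' : (t : ℝ) ≤ T := by exact_mod_cast htT
  rcases hT.eq_or_lt with rfl | h2
  -- At `T = 1` the right-hand root vanishes while the threshold need not; the additive 8 covers it.
  · have h1 : t = 1 := by omega
    subst h1
    have hs : √(Real.log (((tipGrid 1).card : ℝ) * ((1 : ℕ) : ℝ) ^ 2 /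
        (((1 : ℕ) : ℝ) ^ (-(1 + α)))) / ((1 : ℕ) : ℝ)) ≤ 1 := by
      rw [log_threshold_arg le_rfl le_rfl, Real.sqrt_le_one]
      have hc : ((tipGrid 1).card : ℝ) ≤ 2 := by exact_mod_cast card_tipGrid_le 1
      have hl := Real.log_le_sub_one_of_pos (zero_lt_one.trans_le (one_le_card_tipGrid 1))
      simp only [Nat.cast_one, Real.log_one, mul_zero, add_zero, div_one]
      linarith
    rw [vThreshold]
    simp only [Nat.cast_one, one_mul] at hs ⊢
    have : 0 ≤ 24 * √((1 + α) * Real.log 1 / 1) := by positivity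
    linarith
  · have h1 := mul_le_mul_of_nonneg_left (vThreshold_le hα h2 ht htT) ht'.le
    have hL : 0 ≤ (1 + α) * Real.log T :=
      mul_nonneg (by linarith) (Real.log_natCast_nonneg T)
    have key : ∀ x : ℝ, 0 < x → x * √((1 + α) * Real.log T / x) =
        √x * √((1 + α) * Real.log T) := fun x hx => by
      rw [Real.sqrt_div hL]
      nth_rewrite 1 [← Real.mul_self_sqrt hx.le]
      have := (Real.sqrt_pos.2 hx).ne'
      field_simp
    have h3 : (t : ℝ) * √((1 + α) * Real.log T / t) ≤ T * √((1 + α) * Real.log T / T) := by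
      rw [key t ht', key T hT']
      gcongr
    linarith

theorem extReg_switchModel_le {α : ℝ} (hα : 0 < α) {T : ℕ} (hT : 1 ≤ T)
    (M₀ : NextTokenModel Bool) {A : Type*} [Fintype A] [Nonempty A] {U : A → Bool → ℝ}
    (hU : ∀ a y, |U a y| ≤ 1) (θ : Fin T → Bool) :
    extReg U (fun t => qbr U
        (switchModel 8 T ((T : ℝ) ^ (-(1 + α))) M₀ t.val (past θ t)) (1 / √(T : ℝ))) θ ≤
      250 * (Real.log ((Fintype.card A : ℝ) * (T : ℝ)) / √(T : ℝ) +
        √((1 + α) * Real.log (T : ℝ) / (T : ℝ))) := by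
  have hT1 : (1 : ℝ) ≤ T := by exact_mod_cast hT
  have hT' : (0 : ℝ) < T := by linarith
  have hA1 : (1 : ℝ) ≤ Fintype.card A := by exact_mod_cast Fintype.card_pos (α := A)
  have hlA : 0 ≤ Real.log (Fintype.card A) := Real.log_nonneg hA1
  have hlT : 0 ≤ Real.log T := Real.log_nonneg hT1
  have hlog : Real.log ((Fintype.card A : ℝ) * T) = Real.log (Fintype.card A) + Real.log T :=
    Real.log_mul (by linarith) hT'.ne'
  have hS1 : 1 ≤ √(T : ℝ) := Real.one_le_sqrt.2 hT1
  have hSS : √(T : ℝ) * √(T : ℝ) = T := Real.mul_self_sqrt hT'.le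
  have hθ := seqExt_val θ
  set y := seqExt θ
  rw [← hθ, extReg, Finset.sup'_le_iff]
  intro a _
  have hround : ∑ t : Fin T, (U a (y t) - ∑ b, qbr U
      (switchModel 8 T ((T : ℝ) ^ (-(1 + α))) M₀ t.val (past (fun t : Fin T => y t) t))
        (1 / √(T : ℝ)) b * U b (y t)) =
      ∑ s ∈ Finset.range T, (U a (y s) - ∑ b, qbrAt U (1 / √(T : ℝ))
        (switchForecast 8 T ((T : ℝ) ^ (-(1 + α))) M₀ y s) b * U b (y s)) := by
    rw [← Fin.sum_univ_eq_sum_range (fun s => U a (y s) - ∑ b, qbrAt U (1 / √(T : ℝ))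
        (switchForecast 8 T ((T : ℝ) ^ (-(1 + α))) M₀ y s) b * U b (y s))]
    refine Finset.sum_congr rfl fun t _ => ?_
    simp only [qbr_eq_qbrAt]
    rfl
  rw [hround]
  have hη : 0 < 1 / √(T : ℝ) := by positivity
  -- A single action has no regret, and the claimed bound may then be 0. Otherwise `log |A| ≥ 1 / 2`
  -- absorbs the additive constants.
  by_cases hA : Fintype.card A = 1
  · have hzero : ∀ s, U a (y s) - ∑ b, qbrAt U (1 / √(T : ℝ))
        (switchForecast 8 T ((T : ℝ) ^ (-(1 + α))) M₀ y s) b * U b (y s) = 0 := fun s => by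
      have hsub : Subsingleton A := Fintype.card_le_one_iff_subsingleton.1 hA.le
      have h1 : ∀ b, U b (y s) = U a (y s) := fun b => by rw [Subsingleton.elim b a]
      simp only [h1]
      rw [← Finset.sum_mul, sum_qbrAt, one_mul, sub_self]
    rw [Finset.sum_congr rfl fun s _ => hzero s, Finset.sum_const_zero, mul_zero, hlog]
    positivity
  · have hA2 : (2 : ℝ) ≤ Fintype.card A := by
      have := Fintype.card_pos (α := A)
      exact_mod_cast (by omega : 2 ≤ Fintype.card A)
    have hl : 1 / 2 ≤ Real.log (Fintype.card A) :=
      le_trans (by linarith [Real.log_two_gt_d9]) (Real.log_le_log two_pos hA2)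
    have hR0 : 0 ≤ √((1 + α) * Real.log T / T) := Real.sqrt_nonneg _
    have hmain := regret_sum_le (M₀ := M₀) (y := y) (c := 8) (m := T)
      (δ := (T : ℝ) ^ (-(1 + α))) (by norm_num) hT hU hη
      (B := 8 + T * (24 * √((1 + α) * Real.log T / T))) (by positivity) (T := T)
      (fun t h1 h2 => mul_vThreshold_le hα hT h1 h2) a
    have hlog3 : Real.log ((T : ℝ) + 2) ≤ Real.log T + 2 := by
      have h1 : Real.log ((T : ℝ) + 2) ≤ Real.log (T * 3) :=
        Real.log_le_log (by linarith) (by linarith)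
      rw [Real.log_mul hT'.ne' (by norm_num)] at h1
      linarith [Real.log_le_sub_one_of_pos (by norm_num : (0 : ℝ) < 3)]
    set S := √(T : ℝ) with hS
    set R := √((1 + α) * Real.log T / T) with hR
    set a' := Real.log (Fintype.card A)
    set l := Real.log T
    have hS0 : 0 < S := by linarith
    have e1 : 1 / S * a' ≤ a' * S := by
      rw [one_div_mul_eq_div, div_le_iff₀ hS0]
      nlinarith [mul_nonneg hlA hS0.le]
    have e2 : (T : ℝ) * (8 * (8 / (1 / S)) / T + 1 / S * a') = 64 * S + S * a' := by
      rw [← hSS]; field_simp; ring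
    have e3 : 8 / (1 / S) * Real.log (T + 2) ≤ 8 * S * (l + 2) := by
      rw [div_div_eq_mul_div, div_one]
      exact mul_le_mul_of_nonneg_left hlog3 (by positivity)
    have e4 : S ≤ 2 * (S * a') := by nlinarith
    have e5 : 0 ≤ S * l := by positivity
    have e6 : 250 * ((a' + l) / S + R) = (1 / T) * (250 * (S * (a' + l)) + 250 * (T * R)) := by
      rw [← hSS]; field_simp
    have e7 : 0 ≤ (T : ℝ) * R := by positivity
    rw [hlog, e6]
    refine mul_le_mul_of_nonneg_left (hmain.trans ?_) (by positivity)
    rw [e2]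
    linarith

theorem mainTheorem6 :
    ∃ c C : ℝ, 0 < c ∧ 0 < C ∧
      ∀ (α : ℝ), 0 < α → ∀ (T : ℕ), 1 ≤ T →
        ((tipGrid T).card : ℝ) ≤ C * (T : ℝ) ∧
        (2 ≤ T → ∀ t : ℕ, 1 ≤ t → t ≤ T →
          vThreshold c T ((T : ℝ) ^ (-(1 + α))) t ≤
            C * √((1 + α) * Real.log (T : ℝ) / (t : ℝ))) ∧
        ∀ (M₀ : NextTokenModel Bool) (A : Type*) [Fintype A] [Nonempty A],
          (∀ U : A → Bool → ℝ, (∀ a y, |U a y| ≤ 1) → ∀ θ : Fin T → Bool,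
            extReg U
                (fun t => qbr U
                  (switchModel c T ((T : ℝ) ^ (-(1 + α))) M₀ t.val (past θ t)) (1 / √(T : ℝ)))
                θ ≤
              C * (Real.log ((Fintype.card A : ℝ) * (T : ℝ)) / √(T : ℝ) +
                √((1 + α) * Real.log (T : ℝ) / (T : ℝ)))) ∧
          tvDist (inducedDist (switchModel c T ((T : ℝ) ^ (-(1 + α))) M₀) T)
              (inducedDist M₀ T) ≤
            (Fintype.card A : ℝ) * (T : ℝ) ^ (-α) := by
  refine ⟨8, 250, by norm_num, by norm_num, fun α hα T hT => ⟨?_, fun hT2 t ht htT => ?_,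
    fun M₀ A _ _ => ⟨fun U hU θ => extReg_switchModel_le hα hT M₀ hU θ, ?_⟩⟩⟩
  · have h1 : ((tipGrid T).card : ℝ) ≤ T + 1 := by exact_mod_cast card_tipGrid_le T
    have h2 : (1 : ℝ) ≤ T := by exact_mod_cast hT
    linarith
  · refine (vThreshold_le hα hT2 ht htT).trans ?_
    exact mul_le_mul_of_nonneg_right (by norm_num) (Real.sqrt_nonneg _)
  · refine (tvDist_switchModel_le_rpow hα hT M₀).trans ?_
    have hA1 : (1 : ℝ) ≤ Fintype.card A := by exact_mod_cast Fintype.card_pos (α := A)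
    exact le_mul_of_one_le_left (Real.rpow_nonneg (Nat.cast_nonneg T) _) hA1
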